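/- **Equivalence Theorem.** Let $\Gamma$ be a countable discrete group, written multiplicatively. *Actions.* An action of $\Gamma$ on a probability space $(X,\mu)$ is a family $\mathbf T=(T^\gamma)_{\gamma\in\Gamma}$ of $\mu$-preserving measurable maps with $T^{1}=\mathrm{id}$ and $T^{\beta\alpha}=T^\beta\circ T^\alpha$. Actions $(\mathbf T:X,\mu)$ and $(\mathbf R:X',\mu')$ are *isomorphic* ($\mathbf T\cong\mathbf R$) if there are measure-preserving maps $\varphi:X\to X'$ and $\psi:X'\to X$, inverse to each other modulo null sets, with $\varphi T^\gamma=R^\gamma\varphi$ a.e. for every $\gamma$. *Settings.* A *setting* is a topological space $\Omega$ together with an assignment $\omega\mapsto(\mathbf R_\omega:X_\omega,\mu_\omega)$ of a $\Gamma$-action to each point. A property $P$ of $\Gamma$-actions is *saturated* if it depends only on the isomorphism class; it cuts out the set $\{\omega\in\Omega:\mathbf R_\omega\text{ has }P\}$. A subset of a topological space is *Baire* if it is the symmetric difference of an open set and a meager set, and *residual* if its complement is meager. Two settings $\Omega,\Omega'$ are *dynamically generically-equivalent* if, for every saturated property $P$, the set cut out by $P$ in $\Omega$ is Baire (respectively meager,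 residual) if and only if the set cut out by $P$ in $\Omega'$ is. *The setting $\mathbb A$.* Let $Y=[0,1)$ be the circle and $\mathbf m$ Lebesgue measure on it. $\mathbb A$ is the set of $\Gamma$-actions on $(Y,\mathbf m)$, two actions that agree a.e. being identified, with the coarse topology: $\mathbf T_i\to\mathbf R$ iff $\mathbf m(T_i^{-\gamma}E\,\triangle\,R^{-\gamma}E)\to0$ for all $\gamma\in\Gamma$ and all measurable $E\subset Y$ (where $T^{-\gamma}E=(T^\gamma)^{-1}(E)$). *The setting $\bullet\mathrm{SIM}$.* $\bullet\mathrm{SIM}$ is the set of Borel probability measures $\hat\mu$ on $Y^\Gamma$ invariant under all shifts $S^\alpha$, $(S^\alpha\hat y)[\gamma]=\hat y[\gamma\alpha]$, with the weak-$*$ topology; to $\hat\mu$ is assigned the action $(\mathbf S:Y^\Gamma,\hat\mu)$. $\mathrm{SIM}\subset\bullet\mathrm{SIM}$ is the subspace of those $\hat\mu$ whose one-dimensional marginal on $Y$ is non-atomic and gives positive mass to every non-empty open set. A $\hat\mu\in\mathrm{SIM}$ with marginal $\nu$ is a *graph-sim* if for all $\alpha\ne\beta$ in $\Gamma$ its marginal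 on the coordinates $\alpha,\beta$ is the image of $\nu$ under $y\mapsto(y,Ry)$ for some $\nu$-preserving map $R:Y\to Y$. Let $\mathbb H$ be the set of homeomorphisms of the circle which fix $0$ and preserve the order of $[0,1)$, with the topology of uniform convergence. For $h\in\mathbb H$ and $\mathbf T\in\mathbb A$ let $E(h,\mathbf T)$ be the image of $\mathbf m$ under $y\mapsto(h(T^\gamma y))_{\gamma\in\Gamma}$. *Then:* 1. The settings $\mathbb A$ and $\bullet\mathrm{SIM}$ are dynamically generically-equivalent. 2. $E$ is a homeomorphism from $\mathbb H\times\mathbb A$ onto the set of graph-sims, viewed as a subspace of $\mathrm{SIM}$; this set is residual in $\mathrm{SIM}$; and for all $h\in\mathbb H$, $\mathbf T\in\mathbb A$ the action $(\mathbf S:Y^\Gamma,E(h,\mathbf T))$ is isomorphic to $\mathbf T$. -/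

import Mathlib

open MeasureTheory Topology Filter Set
open scoped symmDiff

namespace GenericDynamics

/-- An action of the (discrete) group `Γ` by measure-preserving transformations of `(X, μ)`. The
group is written multiplicatively. As `Γ` is countable and discrete, joint measurability of
`(γ, x) ↦ T^γ x` is measurability of every `T^γ`, which is part of `MeasurePreserving`. -/
structure MPAction (Γ : Type) [Group Γ] (X : Type) [MeasurableSpace X] (μ : Measure X) where
  /-- `tr γ` is the transformation at time `γ`. -/
  tr : Γ → X → X
  tr_one : tr 1 = id
  tr_mul : ∀ β α : Γ, tr (β * α) = tr β ∘ tr α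
  mp : ∀ γ : Γ, MeasurePreserving (tr γ) μ μ

/-- A `Γ`-action on some probability space. -/
structure System (Γ : Type) [Group Γ] where
  X : Type
  [meas : MeasurableSpace X]
  μ : Measure X
  [prob : IsProbabilityMeasure μ]
  action : MPAction Γ X μ

attribute [instance] System.meas System.prob

variable {Γ : Type} [Group Γ]

/-- Isomorphism of actions, modulo null sets: there is an (almost everywhere) invertible bi-measure-
preserving map `φ`, with inverse `ψ`, which conjugates the first action to the second. -/
def Isom (T R : System Γ) : Prop :=
  ∃ (φ : T.X → R.X) (ψ : R.X → T.X),
    MeasurePreserving φ T.μ R.μ ∧ MeasurePreserving ψ R.μ T.μ ∧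
    ψ ∘ φ =ᵐ[T.μ] id ∧ φ ∘ ψ =ᵐ[R.μ] id ∧
    ∀ γ : Γ, φ ∘ T.action.tr γ =ᵐ[T.μ] R.action.tr γ ∘ φ

theorem Isom.refl (T : System Γ) : Isom T T :=
  ⟨id, id, MeasurePreserving.id _, MeasurePreserving.id _, EventuallyEq.rfl, EventuallyEq.rfl,
    fun _ => EventuallyEq.rfl⟩

theorem Isom.symm {T R : System Γ} (h : Isom T R) : Isom R T := by
  obtain ⟨φ, ψ, hφ, hψ, h₁, h₂, h₃⟩ := h
  refine ⟨ψ, φ, hψ, hφ, h₂, h₁, fun γ => ?_⟩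
  have e₁ := (R.action.mp γ).quasiMeasurePreserving.ae h₂
  have e₂ := hψ.quasiMeasurePreserving.ae (h₃ γ)
  have e₃ := ((T.action.mp γ).comp hψ).quasiMeasurePreserving.ae h₁
  filter_upwards [h₂, e₂, e₃] with x a b c
  simp only [Function.comp_apply, id_eq] at a b c ⊢
  rw [a] at b
  rw [← b, c]

theorem Isom.trans {T R Q : System Γ} (h : Isom T R) (k : Isom R Q) : Isom T Q := by
  obtain ⟨φ, ψ, hφ, hψ, h₁, h₂, h₃⟩ := h
  obtain ⟨φ', ψ', hφ', hψ', k₁, k₂, k₃⟩ := k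
  refine ⟨φ' ∘ φ, ψ ∘ ψ', hφ'.comp hφ, hψ.comp hψ', ?_, ?_, fun γ => ?_⟩
  · filter_upwards [h₁, hφ.quasiMeasurePreserving.ae k₁] with x a b
    simp only [Function.comp_apply, id_eq] at a b ⊢
    rw [b, a]
  · filter_upwards [k₂, hψ'.quasiMeasurePreserving.ae h₂] with x a b
    simp only [Function.comp_apply, id_eq] at a b ⊢
    rw [b, a]
  · filter_upwards [h₃ γ, hφ.quasiMeasurePreserving.ae (k₃ γ)] with x a b
    simp only [Function.comp_apply] at a b ⊢
    rw [a, b]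

/-- A setting: a topological space each of whose points names a `Γ`-action. -/
structure Setting (Γ : Type) [Group Γ] where
  Ω : Type
  [top : TopologicalSpace Ω]
  sys : Ω → System Γ

attribute [instance] Setting.top

/-- A property of `Γ`-actions which depends only on the isomorphism class of the action. -/
def IsSaturatedProperty (P : System Γ → Prop) : Prop :=
  ∀ T R : System Γ, Isom T R → (P T ↔ P R)

/-- The points of a setting whose action has the property `P`. -/
def Setting.locus (S : Setting Γ) (P : System Γ → Prop) : Set S.Ω :=
  {ω | P (S.sys ω)}

/-- The saturated subsets of a setting. -/
def Setting.IsSaturated (S : Setting Γ) (B : Set S.Ω) : Prop :=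
  ∀ ω η : S.Ω, Isom (S.sys ω) (S.sys η) → (ω ∈ B ↔ η ∈ B)

/-- The saturated subsets of a setting are exactly the loci of saturated properties. -/
theorem Setting.isSaturated_iff (S : Setting Γ) (B : Set S.Ω) :
    S.IsSaturated B ↔ ∃ P, IsSaturatedProperty P ∧ B = S.locus P := by
  constructor
  · intro hB
    refine ⟨fun T => ∃ ω ∈ B, Isom (S.sys ω) T, fun T R h => ?_, ?_⟩
    · exact ⟨fun ⟨ω, hω, k⟩ => ⟨ω, hω, k.trans h⟩, fun ⟨ω, hω, k⟩ => ⟨ω, hω, k.trans h.symm⟩⟩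
    · ext η
      exact ⟨fun h => ⟨η, h, Isom.refl _⟩, fun ⟨ω, hω, k⟩ => (hB ω η k).1 hω⟩
  · rintro ⟨P, hP, rfl⟩ ω η h
    exact hP _ _ h

/-- Two settings are dynamically generically-equivalent if saturated properties are
Baire / meager / residual in the one iff they are so in the other. -/
def DynGenEquiv (S S' : Setting Γ) : Prop :=
  ∀ P : System Γ → Prop, IsSaturatedProperty P →
    (BaireMeasurableSet (S.locus P) ↔ BaireMeasurableSet (S'.locus P)) ∧
    (IsMeagre (S.locus P) ↔ IsMeagre (S'.locus P)) ∧
    (S.locus P ∈ residual S.Ω ↔ S'.locus P ∈ residual S'.Ω)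

/-! ### The action space -/

/-- The coarse topology on actions: it is generated by the balls of all the pseudometrics
`(T, R) ↦ μ (T^{-γ} E ∆ R^{-γ} E)`, for `γ ∈ Γ` and `E` measurable. -/
instance MPAction.coarseTopology {X : Type} [MeasurableSpace X] {μ : Measure X} :
    TopologicalSpace (MPAction Γ X μ) :=
  TopologicalSpace.generateFrom
    {U | ∃ (γ : Γ) (E : Set X) (R : MPAction Γ X μ) (ε : ENNReal),
      MeasurableSet E ∧ 0 < ε ∧ U = {T | μ ((T.tr γ ⁻¹' E) ∆ (R.tr γ ⁻¹' E)) < ε}}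

/-- Two actions on the same space are identified if they agree almost everywhere. -/
instance MPAction.aeSetoid (Γ : Type) [Group Γ] (X : Type) [MeasurableSpace X] (μ : Measure X) :
    Setoid (MPAction Γ X μ) where
  r T R := ∀ γ : Γ, T.tr γ =ᵐ[μ] R.tr γ
  iseqv := ⟨fun _ _ => EventuallyEq.rfl, fun h γ => (h γ).symm, fun h k γ => (h γ).trans (k γ)⟩

/-- Convergence in the coarse topology. -/
theorem MPAction.tendsto_iff {X : Type} [MeasurableSpace X] {μ : Measure X} {ι : Type*}
    {l : Filter ι} (u : ι → MPAction Γ X μ) (R : MPAction Γ X μ) :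
    Tendsto u l (𝓝 R) ↔ ∀ (γ : Γ) (E : Set X), MeasurableSet E →
      Tendsto (fun i => μ (((u i).tr γ ⁻¹' E) ∆ (R.tr γ ⁻¹' E))) l (𝓝 0) := by
  rw [TopologicalSpace.tendsto_nhds_generateFrom_iff]
  constructor
  · intro h γ E hE
    rw [ENNReal.tendsto_nhds_zero]
    intro ε hε
    have := h _ ⟨γ, E, R, ε, hE, hε, rfl⟩ (by simpa using hε)
    filter_upwards [this] with i hi using le_of_lt hi
  · rintro h s ⟨γ, E, Q, ε, hE, hε, rfl⟩ hR
    change μ ((R.tr γ ⁻¹' E) ∆ (Q.tr γ ⁻¹' E)) < ε at hR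
    have hlim : Tendsto (fun i => μ (((u i).tr γ ⁻¹' E) ∆ (R.tr γ ⁻¹' E)) +
        μ ((R.tr γ ⁻¹' E) ∆ (Q.tr γ ⁻¹' E))) l (𝓝 (0 + μ ((R.tr γ ⁻¹' E) ∆ (Q.tr γ ⁻¹' E)))) :=
      (h γ E hE).add tendsto_const_nhds
    rw [zero_add] at hlim
    filter_upwards [hlim.eventually (gt_mem_nhds hR)] with i hi
    exact (measure_symmDiff_le _ _ _).trans_lt hi

/-- So convergence of classes in the quotient is coarse convergence of any representatives. -/
theorem MPAction.isInducing_mk {X : Type} [MeasurableSpace X] {μ : Measure X} :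
    IsInducing (Quotient.mk (MPAction.aeSetoid Γ X μ)) := by
  have key : ∀ T R : MPAction Γ X μ, (∀ γ, T.tr γ =ᵐ[μ] R.tr γ) →
      ∀ U : Set (MPAction Γ X μ), IsOpen U → T ∈ U → R ∈ U := by
    intro T R h U hU hT
    have ht : Tendsto (fun _ : Unit => R) (pure ()) (𝓝 T) := by
      rw [MPAction.tendsto_iff]
      intro γ E _
      have h0 : μ ((R.tr γ ⁻¹' E) ∆ (T.tr γ ⁻¹' E)) = 0 := by
        rw [measure_symmDiff_eq_zero_iff]
        filter_upwards [h γ] with x hx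
        exact propext (show R.tr γ x ∈ E ↔ T.tr γ x ∈ E by rw [hx])
      simp only [h0]
      exact tendsto_const_nhds
    exact mem_pure.1 (ht (hU.mem_nhds hT))
  refine isInducing_iff_nhds.2 fun R => ?_
  refine le_antisymm (continuous_quotient_mk'.tendsto R).le_comap fun s hs => ?_
  obtain ⟨U, hUs, hU, hRU⟩ := mem_nhds_iff.1 hs
  have hpre : Quotient.mk (MPAction.aeSetoid Γ X μ) ⁻¹' (Quotient.mk _ '' U) = U := by
    ext T
    constructor
    · rintro ⟨Q, hQ, e⟩
      exact key Q T (Quotient.exact e) U hU hQ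
    · exact fun hT => ⟨T, hT, rfl⟩
  refine ⟨Quotient.mk _ '' U, IsOpen.mem_nhds ?_ ⟨R, hRU, rfl⟩, by rw [hpre]; exact hUs⟩
  exact isOpen_coinduced.2 (hpre.symm ▸ hU)

/-- The circle `Y = ℝ / ℤ`; its `volume` is Lebesgue measure, of total mass one. -/
abbrev Y : Type := UnitAddCircle

instance Y.isProbabilityMeasure : IsProbabilityMeasure (volume : Measure Y) :=
  ⟨by simp [AddCircle.measure_univ]⟩

/-- The space `𝔸` of measure-preserving `Γ`-actions on the circle with Lebesgue measure, modulo
almost everywhere equality, with the coarse topology. -/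
abbrev ActionSpace (Γ : Type) [Group Γ] : Type :=
  Quotient (MPAction.aeSetoid Γ Y (volume : Measure Y))

/-- The setting `𝔸`. (Representatives of the same class are isomorphic.) -/
noncomputable def actionSetting (Γ : Type) [Group Γ] : Setting Γ where
  Ω := ActionSpace Γ
  sys T := { X := Y, μ := volume, action := T.out }

/-! ### Shift-invariant measures -/

/-- The shift `S^α` on `Y^Γ`. -/
def shift (α : Γ) (y : Γ → Y) : Γ → Y := fun γ => y (γ * α)

theorem measurable_shift (α : Γ) : Measurable (shift α) :=
  measurable_pi_lambda _ fun γ => measurable_pi_apply (γ * α)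

/-- `•SIM`: the shift-invariant Borel probability measures on `Y^Γ`. -/
def BulletSim (Γ : Type) [Group Γ] : Type :=
  {μ : ProbabilityMeasure (Γ → Y) // ∀ α : Γ, (μ : Measure (Γ → Y)).map (shift α) = μ}

/-- `•SIM` carries the weak-* topology (tested on continuous functions on `Y^Γ`). -/
instance BulletSim.topology [Countable Γ] : TopologicalSpace (BulletSim Γ) :=
  inferInstanceAs (TopologicalSpace
    {μ : ProbabilityMeasure (Γ → Y) // ∀ α : Γ, (μ : Measure (Γ → Y)).map (shift α) = μ})

/-- A sim, as a measure on `Y^Γ`. -/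
def BulletSim.toMeasure (μ : BulletSim Γ) : Measure (Γ → Y) := (μ.1 : Measure (Γ → Y))

instance BulletSim.isProbabilityMeasure (μ : BulletSim Γ) : IsProbabilityMeasure μ.toMeasure :=
  inferInstanceAs (IsProbabilityMeasure (μ.1 : Measure (Γ → Y)))

/-- The shift action on `(Y^Γ, μ)`. -/
def BulletSim.system (μ : BulletSim Γ) : System Γ where
  X := Γ → Y
  μ := μ.toMeasure
  action :=
    { tr := shift
      tr_one := by funext y γ; simp [shift]
      tr_mul := fun β α => by funext y γ; simp [shift, mul_assoc]
      mp := fun α => ⟨measurable_shift α, μ.2 α⟩ }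

/-- The setting `•SIM`. -/
def bulletSimSetting (Γ : Type) [Group Γ] [Countable Γ] : Setting Γ where
  Ω := BulletSim Γ
  sys := BulletSim.system

/-- The one-dimensional marginal of a sim. -/
noncomputable def BulletSim.marg (μ : BulletSim Γ) : Measure Y :=
  μ.toMeasure.map fun y => y 1

/-- The good measures on the circle: non-atomic and of full support. -/
def IsGood (ν : Measure Y) : Prop :=
  (∀ y : Y, ν {y} = 0) ∧ ∀ V : Set Y, IsOpen V → V.Nonempty → 0 < ν V

/-- `SIM`: the sims whose marginal is good, with the topology induced from `•SIM`. -/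
abbrev Sim (Γ : Type) [Group Γ] : Type := {μ : BulletSim Γ // IsGood μ.marg}

/-- A measure `η` on `Y × Y` with both marginals `ν` is a graph joining if it lives on the graph of
a measure-preserving transformation of `(Y, ν)`. -/
def IsGraphJoining (ν : Measure Y) (η : Measure (Y × Y)) : Prop :=
  ∃ R : Y → Y, MeasurePreserving R ν ν ∧ η = ν.map fun y => (y, R y)

/-- The graph-sims: the good sims all of whose two-dimensional marginals are graph joinings. -/
def graphSims (Γ : Type) [Group Γ] : Set (Sim Γ) :=
  {μ | ∀ α β : Γ, α ≠ β →
    IsGraphJoining μ.1.marg (μ.1.toMeasure.map fun y => (y α, y β))}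

/-! ### Adaptations and the map `E` -/

/-- The representative in `[0, 1)` of a point of the circle. -/
noncomputable def coord (y : Y) : ℝ := (AddCircle.equivIco (1 : ℝ) 0 y : ℝ)

/-- `ℍ`: the homeomorphisms of the circle which fix `0` and preserve the order of `[0, 1)`, with the
topology of uniform convergence, i.e. the one induced from `C(Y, Y)`. -/
abbrev Adaptation : Type :=
  {h : C(Y, Y) // IsHomeomorph h ∧ h 0 = 0 ∧ ∀ x y : Y, coord x ≤ coord y → coord (h x) ≤ coord (h y)}

/-- The map `y ↦ (h (T^γ y))_γ` from `Y` to `Y^Γ`. -/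
def orbitMap (h : Y → Y) (T : MPAction Γ Y (volume : Measure Y)) (y : Y) : Γ → Y :=
  fun γ => h (T.tr γ y)

theorem measurable_orbitMap (h : Adaptation) (T : MPAction Γ Y (volume : Measure Y)) :
    Measurable (orbitMap h.1 T) :=
  measurable_pi_lambda _ fun γ => h.1.continuous.measurable.comp (T.mp γ).measurable

/-- The image of Lebesgue measure under `y ↦ (h (T^γ y))_γ`, as a sim. -/
noncomputable def pushSim (h : Adaptation) (T : MPAction Γ Y (volume : Measure Y)) : BulletSim Γ :=
  ⟨⟨(volume : Measure Y).map (orbitMap h.1 T),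
      Measure.isProbabilityMeasure_map (measurable_orbitMap h T).aemeasurable⟩, fun α => by
    have e : shift α ∘ orbitMap h.1 T = orbitMap h.1 T ∘ T.tr α := by
      funext y γ
      simp [shift, orbitMap, T.tr_mul]
    change ((volume : Measure Y).map (orbitMap h.1 T)).map (shift α) =
      (volume : Measure Y).map (orbitMap h.1 T)
    rw [Measure.map_map (measurable_shift α) (measurable_orbitMap h T), e,
      ← Measure.map_map (measurable_orbitMap h T) (T.mp α).measurable, (T.mp α).map_eq]⟩

theorem marg_pushSim (h : Adaptation) (T : MPAction Γ Y (volume : Measure Y)) :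
    (pushSim h T).marg = (volume : Measure Y).map h.1 := by
  change ((volume : Measure Y).map (orbitMap h.1 T)).map (fun y => y 1) = _
  rw [Measure.map_map (measurable_pi_apply 1) (measurable_orbitMap h T)]
  congr 1
  funext y
  simp [orbitMap, T.tr_one]

theorem isGood_marg_pushSim (h : Adaptation) (T : MPAction Γ Y (volume : Measure Y)) :
    IsGood (pushSim h T).marg := by
  have hm : Measurable h.1 := h.1.continuous.measurable
  rw [marg_pushSim]
  refine ⟨fun y => ?_, fun V hV hne => ?_⟩
  · rw [Measure.map_apply hm (measurableSet_singleton y)]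
    have hs : (h.1 ⁻¹' {y}).Subsingleton := fun a ha b hb =>
      h.2.1.injective ((show h.1 a = y from ha).trans (show h.1 b = y from hb).symm)
    obtain h0 | ⟨a, ha⟩ := hs.eq_empty_or_singleton
    · rw [h0, measure_empty]
    · rw [ha]
      have hb := AddCircle.volume_closedBall (T := (1 : ℝ)) (x := a) 0
      simpa using hb
  · rw [Measure.map_apply hm hV.measurableSet]
    obtain ⟨v, hv⟩ := hne
    obtain ⟨a, rfl⟩ := h.2.1.surjective v
    exact (hV.preimage h.1.continuous).measure_pos _ ⟨a, hv⟩

theorem pushSim_congr [Countable Γ] (h : Adaptation)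
    {T R : MPAction Γ Y (volume : Measure Y)} (e : ∀ γ : Γ, T.tr γ =ᵐ[volume] R.tr γ) :
    pushSim h T = pushSim h R := by
  refine Subtype.ext (Subtype.ext ?_)
  change (volume : Measure Y).map (orbitMap h.1 T) = (volume : Measure Y).map (orbitMap h.1 R)
  refine Measure.map_congr ?_
  filter_upwards [ae_all_iff.2 e] with y hy
  funext γ
  simp [orbitMap, hy γ]

/-- The map `E : ℍ × 𝔸 → SIM`: `E (h, T)` is the image of Lebesgue measure under
`y ↦ (h (T^γ y))_γ`. -/
noncomputable def E [Countable Γ] (p : Adaptation × ActionSpace Γ) : Sim Γ :=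
  Quotient.lift (s := MPAction.aeSetoid Γ Y (volume : Measure Y))
    (fun T => (⟨pushSim p.1 T, isGood_marg_pushSim p.1 T⟩ : Sim Γ))
    (fun _ _ e => Subtype.ext (pushSim_congr p.1 e)) p.2

end GenericDynamics

/-!
The map `E` reduces the comparison of the settings `𝔸` and `•SIM` to Baire category arguments. It is
an embedding of `ℍ × 𝔸` whose composition with `SIM ⊆ •SIM` has dense residual range, and the system
`E (h, T)` is isomorphic to `T` for every `h`. So the locus of a saturated property in `•SIM` pulls
back to `ℍ × (its locus in 𝔸)`. An inducing map with dense residual range preserves and reflects the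
meagre, residual and Baire sets (`mem_residual_preimage_iff`), and by the Kuratowski–Ulam theorem
(`eventually_residual_section`) so does the projection of `ℍ × 𝔸` to `𝔸`, because `𝔸` is second
countable and `ℍ` is not meagre in itself.

*Embedding.* `E` is continuous since coarse convergence of actions is convergence in measure, which
implies convergence in law. Conversely, the marginal of `E (h, T)` is the image of Lebesgue measure
under `h`, whose distribution function is the inverse of `h`; weak convergence of such marginals
therefore forces uniform convergence of the adaptations (`tendsto_adaptation`). Once the adaptations
converge, the joint laws of `(y, T^γ y)` converge, and testing against `|g (T^γ y) - b y|`, with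
`b` a continuous approximation of `g ∘ T^γ`, gives strong convergence
(`tendsto_symmDiff_of_integral`).

*Range.* By shift invariance a good sim is a graph-sim iff every coordinate is almost surely a
function `R_γ` of the coordinate at the identity (`mem_graphSims_iff`). A good measure is the image
of Lebesgue measure under an adaptation (`exists_adaptation_map_eq`). The `R_γ` satisfy the axioms
of an action almost everywhere, hence can be corrected on a null set (`exists_mpAction_ae_eq`), and
conjugating them by the adaptation yields a preimage under `E` (`exists_E_eq`).

*Genericity.* `•SIM` is compact and metrizable, hence a Baire space. The good sims with the graph
property are the intersection of countably many open sets: small atoms (`smallAtoms`), positive mass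
on a basic open set, and approximability of the coordinate at `γ` by continuous functions of the
coordinate at the identity (`nearGraph`). For the density of the first and the third kind, a sim `μ`
is realised as the law of `(p (S^γ x))_γ` on the atomless space `Y^Γ × Y`, and `p` is replaced by a
uniformly close injective observable (`exists_injective_near`), which determines the whole orbit.
Mixing with a sim of Lebesgue marginal handles the second kind.
-/

namespace GenericDynamics

/-! ### Transfer of Baire category -/

section Category

variable {W Z : Type*} [TopologicalSpace W] [TopologicalSpace Z]

/-- An inducing map with dense residual range identifies the residual filters: a dense open set
pulls back to a dense open set because the range is dense, and the image of a meagre set is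
meagre. -/
theorem mem_residual_preimage_iff {e : W → Z} (he : IsInducing e) (hd : DenseRange e)
    (hr : range e ∈ residual Z) (S : Set Z) : e ⁻¹' S ∈ residual W ↔ S ∈ residual Z := by
  constructor
  · intro h
    have h1 : IsMeagre (e '' (e ⁻¹' S)ᶜ) :=
      he.isMeagre_image (by rw [IsMeagre, compl_compl]; exact h)
    filter_upwards [h1, hr] with z hz hzr
    obtain ⟨w, rfl⟩ := hzr
    by_contra hw
    exact hz ⟨w, hw, rfl⟩
  · suffices Tendsto e (residual W) (residual Z) from fun h => this h
    apply le_countableGenerate_iff_of_countableInterFilter.mpr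
    rintro t ⟨ht, htd⟩
    refine residual_of_dense_open (ht.preimage he.continuous) ?_
    rw [dense_iff_inter_open]
    intro V hV hne
    obtain ⟨V', hV', rfl⟩ := he.isOpen_iff.1 hV
    obtain ⟨w, hw⟩ := hne
    obtain ⟨z, hz⟩ := dense_iff_inter_open.1 htd V' hV' ⟨e w, hw⟩
    obtain ⟨w', hw'⟩ := hd.exists_mem_open (hV'.inter ht) ⟨z, hz⟩
    exact ⟨w', hw'⟩

theorem isMeagre_preimage_iff {e : W → Z} (he : IsInducing e) (hd : DenseRange e)
    (hr : range e ∈ residual Z) (S : Set Z) : IsMeagre (e ⁻¹' S) ↔ IsMeagre S := by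
  rw [IsMeagre, ← preimage_compl, mem_residual_preimage_iff he hd hr, IsMeagre]

theorem baireMeasurableSet_preimage_iff {e : W → Z} (he : IsInducing e) (hd : DenseRange e)
    (hr : range e ∈ residual Z) (S : Set Z) :
    BaireMeasurableSet (e ⁻¹' S) ↔ BaireMeasurableSet S := by
  rw [BaireMeasurableSet.iff_residualEq_isOpen, BaireMeasurableSet.iff_residualEq_isOpen]
  have key : ∀ U : Set Z, (e ⁻¹' S =ᶠ[residual W] e ⁻¹' U) ↔ S =ᶠ[residual Z] U := by
    intro U
    rw [eventuallyEq_set, eventuallyEq_set]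
    exact mem_residual_preimage_iff he hd hr {z | z ∈ S ↔ z ∈ U}
  constructor
  · rintro ⟨V, hV, h⟩
    obtain ⟨U, hU, rfl⟩ := he.isOpen_iff.1 hV
    exact ⟨U, hU, (key U).1 h⟩
  · rintro ⟨U, hU, h⟩
    exact ⟨e ⁻¹' U, hU.preimage he.continuous, (key U).2 h⟩

/-- One half of the Kuratowski–Ulam theorem: almost every vertical section of a residual subset of
a product is residual, provided that the second factor is second countable. -/
theorem eventually_residual_section [SecondCountableTopology Z] {S : Set (W × Z)}
    (hS : S ∈ residual (W × Z)) : ∀ᶠ w in residual W, Prod.mk w ⁻¹' S ∈ residual Z := by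
  obtain ⟨T, hTo, hTd, hTc, hTS⟩ := mem_residual_iff.1 hS
  have key : ∀ t ∈ T, ∀ᶠ w in residual W, Prod.mk w ⁻¹' t ∈ residual Z := by
    intro t ht
    let B := TopologicalSpace.countableBasis Z
    have hB := TopologicalSpace.isBasis_countableBasis Z
    -- for each basic open `b`, the points `w` whose section meets `b` form a dense open set
    have h1 : ∀ b ∈ B, ∀ᶠ w in residual W, (Prod.mk w ⁻¹' t ∩ b).Nonempty := by
      intro b hb
      have hset : {w : W | (Prod.mk w ⁻¹' t ∩ b).Nonempty} = Prod.fst '' (t ∩ univ ×ˢ b) := by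
        ext w
        constructor
        · rintro ⟨z, hz, hzb⟩
          exact ⟨(w, z), ⟨hz, trivial, hzb⟩, rfl⟩
        · rintro ⟨⟨w', z⟩, ⟨hz, -, hzb⟩, rfl⟩
          exact ⟨z, hz, hzb⟩
      refine residual_of_dense_open (s := {w : W | (Prod.mk w ⁻¹' t ∩ b).Nonempty}) ?_ ?_
      · rw [hset]
        exact isOpenMap_fst _ ((hTo t ht).inter (isOpen_univ.prod (hB.isOpen hb)))
      · rw [dense_iff_inter_open]
        intro V hV hVne
        obtain ⟨⟨w, z⟩, ⟨hw, hz⟩, hwz⟩ := dense_iff_inter_open.1 (hTd t ht) (V ×ˢ b)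
          (hV.prod (hB.isOpen hb))
          (hVne.prod (TopologicalSpace.nonempty_of_mem_countableBasis hb))
        exact ⟨w, hw, z, hwz, hz⟩
    have h2 := (eventually_countable_ball (TopologicalSpace.countable_countableBasis Z)).2 h1
    filter_upwards [h2] with w hw
    refine residual_of_dense_open ((hTo t ht).preimage (Continuous.prodMk_right w)) ?_
    rw [hB.dense_iff]
    intro b hb _
    rw [inter_comm]
    exact hw b hb
  have h3 := (eventually_countable_ball hTc).2 key
  filter_upwards [h3] with w hw
  refine mem_of_superset ((countable_bInter_mem hTc).2 hw) ?_
  intro z hz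
  exact hTS (mem_sInter.2 fun t ht => mem_iInter₂.1 hz t ht)

theorem mem_residual_preimage_snd_iff [SecondCountableTopology Z] [(residual W).NeBot]
    (S : Set Z) : (Prod.snd ⁻¹' S : Set (W × Z)) ∈ residual (W × Z) ↔ S ∈ residual Z := by
  constructor
  · intro h
    obtain ⟨w, hw⟩ := (eventually_residual_section h).exists
    exact hw
  · exact fun h => tendsto_residual_of_isOpenMap continuous_snd isOpenMap_snd h

theorem isMeagre_preimage_snd_iff [SecondCountableTopology Z] [(residual W).NeBot]
    (S : Set Z) : IsMeagre (Prod.snd ⁻¹' S : Set (W × Z)) ↔ IsMeagre S := by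
  rw [IsMeagre, ← preimage_compl, mem_residual_preimage_snd_iff, IsMeagre]

theorem baireMeasurableSet_preimage_snd_iff [SecondCountableTopology Z] [(residual W).NeBot]
    (S : Set Z) : BaireMeasurableSet (Prod.snd ⁻¹' S : Set (W × Z)) ↔ BaireMeasurableSet S := by
  constructor
  · intro h
    obtain ⟨U, hU, h⟩ := h.residualEq_isOpen
    obtain ⟨w, hw⟩ := (eventually_residual_section (eventuallyEq_set.1 h)).exists
    rw [BaireMeasurableSet.iff_residualEq_isOpen]
    exact ⟨Prod.mk w ⁻¹' U, hU.preimage (Continuous.prodMk_right w), eventuallyEq_set.2 hw⟩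
  · exact fun h => h.preimage continuous_snd isOpenMap_snd

end Category

/-! ### The circle and its coordinate -/

theorem coord_mem (y : Y) : coord y ∈ Ico (0 : ℝ) 1 := by
  have h := (AddCircle.equivIco (1 : ℝ) 0 y).2
  exact ⟨h.1, h.2.trans_eq (zero_add 1)⟩

theorem coe_coord (y : Y) : ((coord y : ℝ) : Y) = y := AddCircle.coe_equivIco

theorem coord_coe {t : ℝ} (ht : t ∈ Ico (0 : ℝ) 1) : coord (t : Y) = t :=
  AddCircle.equivIco_coe_of_mem (by rwa [zero_add])

theorem coord_injective : Function.Injective coord := fun x y h => by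
  rw [← coe_coord x, h, coe_coord]

theorem coord_zero : coord (0 : Y) = 0 := coord_coe (t := 0) (by simp)

theorem measurable_coord : Measurable coord :=
  measurable_subtype_coe.comp (AddCircle.measurableEquivIco (1 : ℝ) 0).measurable

theorem dist_coe_le (s t : ℝ) : dist (s : Y) (t : Y) ≤ |s - t| := by
  rw [dist_eq_norm, ← AddCircle.coe_sub]
  exact QuotientAddGroup.norm_mk_le_norm

theorem dist_le_abs_coord_sub (x y : Y) : dist x y ≤ |coord x - coord y| := by
  conv_lhs => rw [← coe_coord x, ← coe_coord y]
  exact dist_coe_le _ _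

/-- Two probability measures on the circle agree if they agree on all initial arcs. -/
theorem measure_ext_coord {ν₁ ν₂ : Measure Y} [IsProbabilityMeasure ν₁] [IsProbabilityMeasure ν₂]
    (h : ∀ c ∈ Ico (0 : ℝ) 1, ν₁ {y | coord y ≤ c} = ν₂ {y | coord y ≤ c}) : ν₁ = ν₂ := by
  have hmap : ν₁.map coord = ν₂.map coord := by
    have := Measure.isProbabilityMeasure_map (μ := ν₁) measurable_coord.aemeasurable
    refine Measure.ext_of_Iic _ _ fun c => ?_
    rw [Measure.map_apply measurable_coord measurableSet_Iic,
      Measure.map_apply measurable_coord measurableSet_Iic]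
    change ν₁ {y | coord y ≤ c} = ν₂ {y | coord y ≤ c}
    rcases lt_or_ge c 0 with hc | hc
    · have : {y : Y | coord y ≤ c} = ∅ :=
        eq_empty_of_forall_notMem fun y hy => absurd (coord_mem y).1 (not_le.2 (hy.trans_lt hc))
      simp [this]
    rcases lt_or_ge c 1 with hc' | hc'
    · exact h c ⟨hc, hc'⟩
    · have : {y : Y | coord y ≤ c} = univ :=
        eq_univ_of_forall fun y => (coord_mem y).2.le.trans hc'
      simp [this]
  have hcoe : Measurable ((↑) : ℝ → Y) := AddCircle.measurable_mk'
  have hid : ((↑) : ℝ → Y) ∘ coord = id := funext coe_coord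
  have h2 := congrArg (Measure.map ((↑) : ℝ → Y)) hmap
  rwa [Measure.map_map hcoe measurable_coord, Measure.map_map hcoe measurable_coord, hid,
    Measure.map_id, Measure.map_id] at h2

theorem map_coord_volume :
    (volume : Measure Y).map coord = (volume : Measure ℝ).restrict (Ioc 0 1) := by
  have h := (AddCircle.measurePreserving_mk (1 : ℝ) 0).map_eq
  rw [zero_add] at h
  rw [← h, Measure.map_map measurable_coord AddCircle.measurable_mk']
  conv_rhs => rw [← Measure.map_id (μ := (volume : Measure ℝ).restrict (Ioc 0 1))]
  refine Measure.map_congr ?_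
  have h1 : ∀ᵐ t ∂(volume : Measure ℝ).restrict (Ioc 0 1), t ≠ 1 := by
    refine ae_restrict_of_ae ?_
    simp [ae_iff]
  filter_upwards [h1, ae_restrict_mem measurableSet_Ioc] with t ht ht'
  exact coord_coe ⟨ht'.1.le, lt_of_le_of_ne ht'.2 ht⟩

theorem volume_coord_le {c : ℝ} (hc : c ∈ Ico (0 : ℝ) 1) :
    (volume : Measure Y) {y | coord y ≤ c} = ENNReal.ofReal c := by
  have h : (volume : Measure Y) {y | coord y ≤ c} = (volume : Measure Y).map coord (Iic c) :=
    (Measure.map_apply measurable_coord measurableSet_Iic).symm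
  rw [h, map_coord_volume, Measure.restrict_apply measurableSet_Iic]
  have : Iic c ∩ Ioc 0 1 = Ioc 0 c := by
    ext t
    simp only [mem_inter_iff, mem_Iic, mem_Ioc]
    exact ⟨fun h => ⟨h.2.1, h.1⟩, fun h => ⟨h.2, h.1, h.2.trans hc.2.le⟩⟩
  rw [this, Real.volume_Ioc, sub_zero]

instance Y.nullSingletonClass : NullSingletonClass (volume : Measure Y) := ⟨fun a => by
  have hb := AddCircle.volume_closedBall (T := (1 : ℝ)) (x := a) 0
  simpa using hb⟩

/-! ### Good measures and adaptations -/

theorem isOpen_coe_image_Ioo (a b : ℝ) : IsOpen (((↑) : ℝ → Y) '' Ioo a b) :=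
  QuotientAddGroup.isOpenMap_coe _ isOpen_Ioo

theorem isClosed_coe_image_Icc (a b : ℝ) : IsClosed (((↑) : ℝ → Y) '' Icc a b) :=
  (isCompact_Icc.image (AddCircle.continuous_mk' 1)).isClosed

theorem coe_coord_mem_image {s : Set ℝ} {y : Y} (h : coord y ∈ s) : y ∈ ((↑) : ℝ → Y) '' s :=
  ⟨coord y, h, coe_coord y⟩

theorem coord_mem_of_mem_image {s : Set ℝ} (hs : s ⊆ Ico 0 1) {y : Y}
    (h : y ∈ ((↑) : ℝ → Y) '' s) : coord y ∈ s := by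
  obtain ⟨t, ht, rfl⟩ := h
  rwa [coord_coe (hs ht)]

theorem measure_closedArc_lt_openArc {ν : Measure Y} [IsProbabilityMeasure ν] (hν : IsGood ν)
    {s t : ℝ} (hs : 0 ≤ s) (hst : s < t) (ht : t ≤ 1) :
    ν (((↑) : ℝ → Y) '' Icc 0 s) < ν (((↑) : ℝ → Y) '' Ioo 0 t) := by
  have hpos : 0 < ν (((↑) : ℝ → Y) '' Ioo s t) :=
    hν.2 _ (isOpen_coe_image_Ioo s t) ((nonempty_Ioo.2 hst).image _)
  have hI : Icc 0 s ⊆ Ico (0 : ℝ) 1 := fun x hx => ⟨hx.1, hx.2.trans_lt (hst.trans_le ht)⟩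
  have hJ : Ioo s t ⊆ Ico (0 : ℝ) 1 := fun x hx => ⟨hs.trans hx.1.le, hx.2.trans_le ht⟩
  have hdisj : Disjoint (((↑) : ℝ → Y) '' Icc 0 s) (((↑) : ℝ → Y) '' Ioo s t) := by
    rw [Set.disjoint_left]
    intro y hy hy'
    exact absurd (coord_mem_of_mem_image hI hy).2 (not_le.2 (coord_mem_of_mem_image hJ hy').1)
  calc ν (((↑) : ℝ → Y) '' Icc 0 s)
      < ν (((↑) : ℝ → Y) '' Icc 0 s) + ν (((↑) : ℝ → Y) '' Ioo s t) :=
        ENNReal.lt_add_right (measure_ne_top _ _) hpos.ne'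
    _ = ν (((↑) : ℝ → Y) '' Icc 0 s ∪ ((↑) : ℝ → Y) '' Ioo s t) :=
        (measure_union hdisj (isOpen_coe_image_Ioo s t).measurableSet).symm
    _ ≤ ν ({0} ∪ ((↑) : ℝ → Y) '' Ioo 0 t) := by
        refine measure_mono ?_
        rintro y (hy | hy)
        · have h := coord_mem_of_mem_image hI hy
          rcases h.1.eq_or_lt with h0 | h0
          · left
            exact coord_injective (h0.symm.trans coord_zero.symm)
          · exact Or.inr (coe_coord_mem_image ⟨h0, h.2.trans_lt hst⟩)
        · have h := coord_mem_of_mem_image hJ hy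
          exact Or.inr (coe_coord_mem_image ⟨hs.trans_lt h.1, h.2⟩)
    _ ≤ ν {0} + ν (((↑) : ℝ → Y) '' Ioo 0 t) := measure_union_le _ _
    _ = ν (((↑) : ℝ → Y) '' Ioo 0 t) := by rw [hν.1 0, zero_add]

theorem continuous_cdf_of_noAtoms (ρ : Measure ℝ) [IsProbabilityMeasure ρ]
    (h : ∀ a, ρ {a} = 0) : Continuous (ProbabilityTheory.cdf ρ) := by
  rw [continuous_iff_continuousAt]
  intro a
  set F := ProbabilityTheory.cdf ρ with hF
  have h1 : ENNReal.ofReal (F a - Function.leftLim F a) = 0 := by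
    rw [← StieltjesFunction.measure_singleton, ProbabilityTheory.measure_cdf, h a]
  have h2 : Function.leftLim F a = F a :=
    le_antisymm (F.mono.leftLim_le le_rfl) (by rw [ENNReal.ofReal_eq_zero] at h1; linarith)
  exact continuousAt_iff_continuous_left'_right'.2
    ⟨(F.mono.continuousWithinAt_Iio_iff_leftLim_eq).2 h2,
      (F.right_continuous a).mono Ioi_subset_Ici_self⟩

/-- Every good measure on the circle is the image of Lebesgue measure under an adaptation, namely
the inverse of its distribution function. -/
theorem exists_adaptation_map_eq {ν : Measure Y} [IsProbabilityMeasure ν] (hν : IsGood ν) :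
    ∃ h : Adaptation, (volume : Measure Y).map h.1 = ν := by
  let ρ : Measure ℝ := ν.map coord
  have : IsProbabilityMeasure ρ := Measure.isProbabilityMeasure_map measurable_coord.aemeasurable
  have hρ : ∀ s, MeasurableSet s → ρ s = ν (coord ⁻¹' s) := fun s hs =>
    Measure.map_apply measurable_coord hs
  have hatom : ∀ a, ρ {a} = 0 := by
    intro a
    rw [hρ _ (measurableSet_singleton a)]
    have hs : (coord ⁻¹' {a}).Subsingleton := fun x hx y hy =>
      coord_injective ((show coord x = a from hx).trans (show coord y = a from hy).symm)
    obtain h0 | ⟨x, hx⟩ := hs.eq_empty_or_singleton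
    · rw [h0, measure_empty]
    · rw [hx, hν.1]
  let F := ProbabilityTheory.cdf ρ
  have hFc : Continuous F := continuous_cdf_of_noAtoms ρ hatom
  have hF : ∀ t, ENNReal.ofReal (F t) = ν {y | coord y ≤ t} := fun t => by
    rw [ProbabilityTheory.ofReal_cdf, hρ _ measurableSet_Iic]
    rfl
  have hF0 : F 0 = 0 := by
    refine le_antisymm (ENNReal.ofReal_eq_zero.1 ?_) (ProbabilityTheory.cdf_nonneg _ _)
    rw [hF, ← hν.1 0]
    congr 1
    ext y
    constructor
    · exact fun hy => coord_injective
        ((le_antisymm hy (coord_mem y).1).trans coord_zero.symm)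
    · rintro rfl
      exact coord_zero.le
  have hF1 : F 1 = 1 := by
    have h1 := hF 1
    have : {y : Y | coord y ≤ 1} = univ := eq_univ_of_forall fun y => (coord_mem y).2.le
    rw [this, measure_univ] at h1
    simpa using congrArg ENNReal.toReal h1 |>.symm.trans
      (ENNReal.toReal_ofReal (ProbabilityTheory.cdf_nonneg _ _)) |>.symm
  have hmono : StrictMonoOn F (Icc 0 1) := by
    intro a ha b hb hab
    have h1 : ENNReal.ofReal (F b - F a) = ρ (Ioc a b) := by
      rw [← StieltjesFunction.measure_Ioc, ProbabilityTheory.measure_cdf]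
    have h2 : 0 < ρ (Ioc a b) := by
      rw [hρ _ measurableSet_Ioc]
      refine (hν.2 _ (isOpen_coe_image_Ioo a b) ((nonempty_Ioo.2 hab).image _)).trans_le
        (measure_mono fun y hy => ?_)
      exact Ioo_subset_Ioc_self (coord_mem_of_mem_image
        (fun x hx => ⟨ha.1.trans hx.1.le, hx.2.trans_le hb.2⟩) hy)
    rw [← h1, ENNReal.ofReal_pos] at h2
    linarith
  have hIco : ∀ y : Y, coord y ∈ Icc (0 : ℝ) 1 := fun y => Ico_subset_Icc_self (coord_mem y)
  have hFmem : ∀ t ∈ Ico (0 : ℝ) 1, F t ∈ Ico (0 : ℝ) 1 := fun t ht =>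
    ⟨ProbabilityTheory.cdf_nonneg _ _, by
      rw [← hF1]
      exact hmono (Ico_subset_Icc_self ht) (right_mem_Icc.2 zero_le_one) ht.2⟩
  let Φ : Y → Y := AddCircle.liftIco 1 0 fun t => ((F t : ℝ) : Y)
  have hΦc : Continuous Φ := by
    refine AddCircle.liftIco_zero_continuous ?_
      ((AddCircle.continuous_mk' 1).comp hFc).continuousOn
    rw [hF0, hF1, AddCircle.coe_zero, AddCircle.coe_period]
  have hΦ : ∀ y, coord (Φ y) = F (coord y) := fun y => coord_coe (hFmem _ (coord_mem y))
  have hinj : Function.Injective Φ := fun x y hxy => coord_injective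
    (hmono.injOn (hIco x) (hIco y) (by rw [← hΦ, ← hΦ, hxy]))
  have hsurj : Function.Surjective Φ := by
    intro y
    obtain ⟨t, ht, hty⟩ := intermediate_value_Icc zero_le_one hFc.continuousOn
      (show coord y ∈ Icc (F 0) (F 1) by rw [hF0, hF1]; exact hIco y)
    have ht1 : t ≠ 1 := by
      rintro rfl
      exact (coord_mem y).2.ne (hty.symm.trans hF1)
    refine ⟨(t : Y), coord_injective ?_⟩
    rw [hΦ, coord_coe ⟨ht.1, lt_of_le_of_ne ht.2 ht1⟩, hty]
  let e : Y ≃ₜ Y := Continuous.homeoOfEquivCompactToT2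
    (f := Equiv.ofBijective Φ ⟨hinj, hsurj⟩) hΦc
  have he : ∀ y, F (coord (e.symm y)) = coord y := fun y => by
    rw [← hΦ]
    exact congrArg coord (e.apply_symm_apply y)
  have hle : ∀ (y : Y) (s : ℝ), s ∈ Ico (0 : ℝ) 1 → (coord (e.symm y) ≤ s ↔ coord y ≤ F s) :=
    fun y s hs => by
      rw [← he y]
      exact (hmono.le_iff_le (hIco _) (Ico_subset_Icc_self hs)).symm
  refine ⟨⟨⟨e.symm, e.symm.continuous⟩, e.symm.isHomeomorph, ?_, ?_⟩, ?_⟩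
  · refine coord_injective (hmono.injOn (hIco _) (hIco _) ?_)
    change F (coord (e.symm 0)) = _
    rw [he, coord_zero, hF0]
  · intro x y hxy
    change coord (e.symm x) ≤ coord (e.symm y)
    rwa [hle _ _ (coord_mem _), he]
  · have hm : Measurable e.symm := e.symm.continuous.measurable
    have : IsProbabilityMeasure ((volume : Measure Y).map e.symm) :=
      Measure.isProbabilityMeasure_map hm.aemeasurable
    change (volume : Measure Y).map e.symm = ν
    refine measure_ext_coord fun c hc => ?_
    rw [Measure.map_apply hm (measurableSet_le measurable_coord measurable_const), ← hF,
      ← volume_coord_le (hFmem c hc)]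
    congr 1
    ext y
    exact hle y c hc

/-- The action by the identity. -/
def trivialAction (Γ : Type) [Group Γ] (X : Type) [MeasurableSpace X] (μ : Measure X) :
    MPAction Γ X μ where
  tr _ := id
  tr_one := rfl
  tr_mul _ _ := rfl
  mp _ := MeasurePreserving.id μ

theorem isGood_map_adaptation (h : Adaptation) : IsGood ((volume : Measure Y).map h.1) := by
  rw [← marg_pushSim h (trivialAction Unit Y volume)]
  exact isGood_marg_pushSim h _

theorem ofReal_coord_le_map_closedArc (h : Adaptation) {y : Y} {s : ℝ} (hy : coord (h.1 y) ≤ s) :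
    ENNReal.ofReal (coord y) ≤ (volume : Measure Y).map h.1 (((↑) : ℝ → Y) '' Icc 0 s) := by
  rw [Measure.map_apply h.1.continuous.measurable (isClosed_coe_image_Icc 0 s).measurableSet,
    ← volume_coord_le (coord_mem y)]
  exact measure_mono fun z hz =>
    coe_coord_mem_image ⟨(coord_mem _).1, (h.2.2.2 z y hz).trans hy⟩

theorem map_openArc_le_ofReal_coord (h : Adaptation) {y : Y} {s : ℝ} (hy : s ≤ coord (h.1 y)) :
    (volume : Measure Y).map h.1 (((↑) : ℝ → Y) '' Ioo 0 s) ≤ ENNReal.ofReal (coord y) := by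
  rw [Measure.map_apply h.1.continuous.measurable (isOpen_coe_image_Ioo 0 s).measurableSet,
    ← volume_coord_le (coord_mem y)]
  refine measure_mono fun z hz => ?_
  have hs : Ioo 0 s ⊆ Ico (0 : ℝ) 1 := fun x hx =>
    ⟨hx.1.le, hx.2.trans (hy.trans_lt (coord_mem _).2)⟩
  have h1 : coord (h.1 z) < coord (h.1 y) := (coord_mem_of_mem_image hs hz).2.trans_le hy
  by_contra hlt
  exact absurd (h.2.2.2 y z (not_le.1 hlt).le) (not_le.2 h1)

/-- Weak convergence of the image measures of adaptations forces uniform convergence of the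
adaptations: the distribution functions converge at all points of a fine grid, and the limit is
strictly increasing along the grid. -/
theorem tendsto_adaptation {ι : Type*} {l : Filter ι} {u : ι → Adaptation} {h : Adaptation}
    {ν : ι → ProbabilityMeasure Y} {ν₀ : ProbabilityMeasure Y} (hν : Tendsto ν l (𝓝 ν₀))
    (hu : ∀ i, (ν i : Measure Y) = (volume : Measure Y).map (u i).1)
    (hh : (ν₀ : Measure Y) = (volume : Measure Y).map h.1) : Tendsto u l (𝓝 h) := by
  rw [tendsto_subtype_rng, ContinuousMap.tendsto_iff_tendstoUniformly,
    Metric.tendstoUniformly_iff]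
  intro ε hε
  obtain ⟨k, hk⟩ := exists_nat_gt (2 / ε)
  have hk0 : (0 : ℝ) < k := (div_pos two_pos hε).trans hk
  have hk' : 2 / (k : ℝ) < ε := by
    rw [div_lt_iff₀ hε] at hk
    rw [div_lt_iff₀ hk0]
    linarith
  have hgood : IsGood (ν₀ : Measure Y) := hh ▸ isGood_map_adaptation h
  have key : ∀ᶠ i in l, ∀ j ∈ Finset.range k,
      (ν i : Measure Y) (((↑) : ℝ → Y) '' Icc 0 (j / k)) <
        (ν₀ : Measure Y) (((↑) : ℝ → Y) '' Ioo 0 ((j + 1) / k)) ∧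
      (ν₀ : Measure Y) (((↑) : ℝ → Y) '' Icc 0 (j / k)) <
        (ν i : Measure Y) (((↑) : ℝ → Y) '' Ioo 0 ((j + 1) / k)) := by
    rw [Finset.eventually_all]
    intro j hj
    have hj1 : ((j : ℝ) + 1) / k ≤ 1 := by
      rw [div_le_one hk0]
      exact_mod_cast Finset.mem_range.1 hj
    have hlt := measure_closedArc_lt_openArc hgood (s := j / k) (t := (j + 1) / k) (by positivity)
      (by gcongr; linarith) hj1
    refine (eventually_lt_of_limsup_lt ?_).and (eventually_lt_of_lt_liminf ?_)
    · exact (ProbabilityMeasure.limsup_measure_closed_le_of_tendsto hν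
        (isClosed_coe_image_Icc _ _)).trans_lt hlt
    · exact hlt.trans_le (ProbabilityMeasure.le_liminf_measure_open_of_tendsto hν
        (isOpen_coe_image_Ioo _ _))
  -- the grid point following `a` is separated from `b` by a full grid interval
  have hgrid : ∀ a b : ℝ, 0 ≤ a → b < 1 → a + 2 / k ≤ b →
      ∃ j ∈ Finset.range k, a ≤ j / k ∧ ((j : ℝ) + 1) / k ≤ b := by
    intro a b ha hb hab
    have h1 : (⌈k * a⌉₊ : ℝ) < k * a + 1 := Nat.ceil_lt_add_one (by positivity)
    have h2 : ((⌈k * a⌉₊ : ℝ) + 1) / k ≤ b := by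
      rw [div_le_iff₀ hk0]
      have := mul_le_mul_of_nonneg_right hab hk0.le
      rw [add_mul, div_mul_cancel₀ _ hk0.ne'] at this
      linarith
    refine ⟨⌈k * a⌉₊, ?_, ?_, h2⟩
    · have h3 := h2.trans_lt hb
      rw [div_lt_one hk0] at h3
      rw [Finset.mem_range]
      have : (⌈k * a⌉₊ : ℝ) < k := by linarith
      exact_mod_cast this
    · rw [le_div_iff₀ hk0, mul_comm]
      exact Nat.le_ceil _
  filter_upwards [key] with i hi y
  refine (dist_le_abs_coord_sub _ _).trans_lt (lt_of_lt_of_le ?_ hk'.le)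
  rw [abs_sub_lt_iff]
  constructor
  · by_contra hcon
    obtain ⟨j, hj, hj1, hj2⟩ := hgrid (coord ((u i).1 y)) (coord (h.1 y)) (coord_mem _).1
      (coord_mem _).2 (by linarith)
    have h1 := ofReal_coord_le_map_closedArc (u i) hj1
    have h2 := map_openArc_le_ofReal_coord h hj2
    rw [← hu] at h1
    rw [← hh] at h2
    exact absurd (h2.trans h1) (not_le.2 (hi j hj).1)
  · by_contra hcon
    obtain ⟨j, hj, hj1, hj2⟩ := hgrid (coord (h.1 y)) (coord ((u i).1 y)) (coord_mem _).1
      (coord_mem _).2 (by linarith)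
    have h1 := ofReal_coord_le_map_closedArc h hj1
    have h2 := map_openArc_le_ofReal_coord (u i) hj2
    rw [← hu] at h2
    rw [← hh] at h1
    exact absurd (h2.trans h1) (not_le.2 (hi j hj).2)

/-! ### Actions modulo null sets -/

variable {Γ : Type} [Group Γ]

/-- A countable family of measure-preserving maps that satisfies the axioms of an action almost
everywhere agrees almost everywhere with an action: on the conull invariant set where all the
axioms hold along the whole orbit nothing is changed, and elsewhere the action is made trivial. -/
theorem exists_mpAction_ae_eq [Countable Γ] {X : Type} [MeasurableSpace X] [MeasurableEq X]
    {μ : Measure X} (R : Γ → X → X)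
    (hR : ∀ γ, MeasurePreserving (R γ) μ μ) (h1 : R 1 =ᵐ[μ] id)
    (hmul : ∀ β α, R (β * α) =ᵐ[μ] R β ∘ R α) :
    ∃ T : MPAction Γ X μ, ∀ γ, T.tr γ =ᵐ[μ] R γ := by
  classical
  let C : Set X := {x | R 1 x = x ∧ ∀ β α, R (β * α) x = R β (R α x)}
  have hCm : MeasurableSet C := by
    have : C = {x | R 1 x = x} ∩ ⋂ β, ⋂ α, {x | R (β * α) x = R β (R α x)} := by
      ext x
      simp [C]
    rw [this]
    refine (measurableSet_eq_fun (hR 1).measurable measurable_id).inter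
      (MeasurableSet.iInter fun β => MeasurableSet.iInter fun α => ?_)
    exact measurableSet_eq_fun (hR _).measurable ((hR β).measurable.comp (hR α).measurable)
  have hC : ∀ᵐ x ∂μ, x ∈ C := by
    filter_upwards [h1, ae_all_iff.2 fun β => ae_all_iff.2 fun α => hmul β α] with x hx hx'
    exact ⟨hx, hx'⟩
  let D : Set X := {x | x ∈ C ∧ ∀ γ, R γ x ∈ C}
  have hDm : MeasurableSet D := by
    have : D = C ∩ ⋂ γ, R γ ⁻¹' C := by
      ext x
      simp [D]
    rw [this]
    exact hCm.inter (MeasurableSet.iInter fun γ => (hR γ).measurable hCm)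
  have hD : ∀ᵐ x ∂μ, x ∈ D := by
    filter_upwards [hC, ae_all_iff.2 fun γ => (hR γ).quasiMeasurePreserving.ae hC] with x hx hx'
    exact ⟨hx, hx'⟩
  have hinv : ∀ γ, ∀ x ∈ D, R γ x ∈ D := by
    intro γ x hx
    refine ⟨hx.2 γ, fun β => ?_⟩
    rw [← hx.1.2 β γ]
    exact hx.2 _
  let T : Γ → X → X := fun γ => D.piecewise (R γ) id
  have hTR : ∀ γ, T γ =ᵐ[μ] R γ := by
    intro γ
    filter_upwards [hD] with x hx
    exact piecewise_eq_of_mem _ _ _ hx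
  have hTm : ∀ γ, Measurable (T γ) := fun γ =>
    Measurable.piecewise hDm (hR γ).measurable measurable_id
  refine ⟨⟨T, ?_, ?_, fun γ => ⟨hTm γ, ?_⟩⟩, hTR⟩
  · funext x
    by_cases hx : x ∈ D
    · simpa [T, hx] using hx.1.1
    · simp [T, hx]
  · intro β α
    funext x
    by_cases hx : x ∈ D
    · simp [T, hx, hinv α x hx, hx.1.2 β α]
    · simp [T, hx]
  · rw [Measure.map_congr (hTR γ), (hR γ).map_eq]

/-! ### Convergence in measure and convergence in law -/

/-- Coarse convergence of maps into the circle implies convergence in measure: cover the circle by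
finitely many small sets. -/
theorem tendsto_measure_le_dist {Ω ι : Type*} [MeasurableSpace Ω] {P : Measure Ω} {l : Filter ι}
    {u : ι → Ω → Y} {v : Ω → Y}
    (h : ∀ A : Set Y, MeasurableSet A → Tendsto (fun i => P ((u i ⁻¹' A) ∆ (v ⁻¹' A))) l (𝓝 0))
    {f : Y → Y} (hf : Continuous f) {δ : ℝ} (hδ : 0 < δ) :
    Tendsto (fun i => P {ω | δ ≤ dist (f (u i ω)) (f (v ω))}) l (𝓝 0) := by
  obtain ⟨t, -, ht⟩ := isCompact_univ.elim_nhds_subcover (fun a : Y => Metric.ball a (δ / 2))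
    fun a _ => Metric.ball_mem_nhds a (half_pos hδ)
  have hsum : Tendsto (fun i => ∑ a ∈ t, P ((u i ⁻¹' (f ⁻¹' Metric.ball a (δ / 2))) ∆
      (v ⁻¹' (f ⁻¹' Metric.ball a (δ / 2))))) l (𝓝 (∑ _a ∈ t, 0)) :=
    tendsto_finsetSum _ fun a _ => h _ (Metric.isOpen_ball.preimage hf).measurableSet
  rw [Finset.sum_const_zero] at hsum
  refine tendsto_of_tendsto_of_tendsto_of_le_of_le tendsto_const_nhds hsum
    (fun _ => zero_le) fun i => ?_
  refine (measure_mono fun ω hω => ?_).trans (measure_biUnion_finset_le t _)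
  obtain ⟨a, ha, hav⟩ := mem_iUnion₂.1 (ht (mem_univ (f (v ω))))
  refine mem_iUnion₂.2 ⟨a, ha, Or.inr ⟨hav, fun hau => ?_⟩⟩
  have h1 : dist (f (u i ω)) a < δ / 2 := hau
  have h2 : dist (f (v ω)) a < δ / 2 := hav
  have h3 := dist_triangle_right (f (u i ω)) (f (v ω)) a
  have h4 : δ ≤ dist (f (u i ω)) (f (v ω)) := hω
  linarith

/-- Convergence in measure of every coordinate of a random element of a power of the circle implies
convergence of expectations of continuous functions. -/
theorem tendsto_integral_comp {κ Ω ι : Type*} [Countable κ] [MeasurableSpace Ω] {P : Measure Ω}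
    [IsProbabilityMeasure P] {l : Filter ι} {Φ : ι → Ω → κ → Y} {Φ₀ : Ω → κ → Y}
    (hΦ : ∀ i, Measurable (Φ i)) (hΦ₀ : Measurable Φ₀)
    (h : ∀ γ, ∀ δ > 0, Tendsto (fun i => P {ω | δ ≤ dist (Φ i ω γ) (Φ₀ ω γ)}) l (𝓝 0))
    (f : C(κ → Y, ℝ)) :
    Tendsto (fun i => ∫ ω, f (Φ i ω) ∂P) l (𝓝 (∫ ω, f (Φ₀ ω) ∂P)) := by
  -- the sets of pairs which contain `(Φ i, Φ₀)` with probability tending to one form a filter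
  let F : Filter ((κ → Y) × (κ → Y)) :=
    { sets := {V | Tendsto (fun i => P {ω | (Φ i ω, Φ₀ ω) ∉ V}) l (𝓝 0)}
      univ_sets := by simpa using tendsto_const_nhds
      sets_of_superset := fun {V V'} hV hVV' =>
        tendsto_of_tendsto_of_tendsto_of_le_of_le tendsto_const_nhds hV (fun _ => zero_le)
          fun i => measure_mono fun ω hω hω' => hω (hVV' hω')
      inter_sets := fun {V V'} hV hV' => by
        have h0 := Tendsto.add hV hV'
        rw [add_zero] at h0
        refine tendsto_of_tendsto_of_tendsto_of_le_of_le tendsto_const_nhds h0 (fun _ => zero_le)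
          fun i => (measure_mono fun ω hω => ?_).trans (measure_union_le _ _)
        by_contra hcon
        simp only [mem_union, mem_ofPred_eq, not_or, not_not] at hcon
        exact hω hcon }
  have hF : F ≤ uniformity (κ → Y) := by
    rw [Pi.uniformity]
    refine le_iInf fun γ => ?_
    rw [← map_le_iff_le_comap]
    intro V hV
    obtain ⟨δ, hδ, hδV⟩ := Metric.mem_uniformity_dist.1 hV
    refine tendsto_of_tendsto_of_tendsto_of_le_of_le tendsto_const_nhds (h γ δ hδ)
      (fun _ => zero_le) fun i => measure_mono fun ω hω => ?_
    by_contra hcon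
    exact hω (hδV (not_le.1 hcon))
  have huc : UniformContinuous f := CompactSpace.uniformContinuous_of_continuous f.continuous
  have hint : ∀ Ψ : Ω → κ → Y, Measurable Ψ → Integrable (fun ω => f (Ψ ω)) P := fun Ψ hΨ =>
    Integrable.of_bound (f.continuous.measurable.comp hΨ).aestronglyMeasurable ‖f‖
      (ae_of_all _ fun ω => f.norm_coe_le_norm _)
  rw [Metric.tendsto_nhds]
  intro ε hε
  set B : ι → Set Ω := fun i => {ω | ε / 2 ≤ dist (f (Φ i ω)) (f (Φ₀ ω))} with hB
  have hBm : ∀ i, MeasurableSet (B i) := fun i => measurableSet_le measurable_const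
    ((f.continuous.measurable.comp (hΦ i)).dist (f.continuous.measurable.comp hΦ₀))
  have hBlim : Tendsto (fun i => P.real (B i)) l (𝓝 0) := by
    have h1 : {p : (κ → Y) × (κ → Y) | dist (f p.1) (f p.2) < ε / 2} ∈ F :=
      hF (huc (Metric.dist_mem_uniformity (half_pos hε)))
    have h2 : Tendsto (fun i => P (B i)) l (𝓝 0) := by
      refine Tendsto.congr (fun i => ?_) h1
      simp only [hB, mem_ofPred_eq, not_lt]
    exact (ENNReal.tendsto_toReal ENNReal.zero_ne_top).comp h2
  have hpos : 0 < ε / 2 / (2 * ‖f‖ + 1) := by positivity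
  filter_upwards [hBlim.eventually (gt_mem_nhds hpos)] with i hi
  rw [lt_div_iff₀ (by positivity)] at hi
  rw [Real.dist_eq, ← integral_sub (hint _ (hΦ i)) (hint _ hΦ₀)]
  have hbound : ∀ ω, ‖f (Φ i ω) - f (Φ₀ ω)‖ ≤
      ε / 2 + (B i).indicator (fun _ => 2 * ‖f‖) ω := by
    intro ω
    by_cases hω : ω ∈ B i
    · rw [indicator_of_mem hω]
      have h1 := norm_sub_le (f (Φ i ω)) (f (Φ₀ ω))
      have h2 := f.norm_coe_le_norm (Φ i ω)
      have h3 := f.norm_coe_le_norm (Φ₀ ω)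
      linarith
    · rw [indicator_of_notMem hω, add_zero]
      exact (not_le.1 hω).le
  calc |∫ ω, (f (Φ i ω) - f (Φ₀ ω)) ∂P|
      ≤ ∫ ω, (ε / 2 + (B i).indicator (fun _ => 2 * ‖f‖) ω) ∂P :=
        norm_integral_le_of_norm_le ((integrable_const _).add
          ((integrable_const _).indicator (hBm i))) (ae_of_all _ hbound)
    _ = ε / 2 + P.real (B i) * (2 * ‖f‖) := by
        rw [integral_add (integrable_const _) ((integrable_const _).indicator (hBm i)),
          integral_indicator_const _ (hBm i)]
        simp
    _ < ε := by nlinarith [measureReal_nonneg (μ := P) (s := B i)]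

theorem BulletSim.isEmbedding_val [Countable Γ] :
    IsEmbedding (fun μ : BulletSim Γ => (μ.1 : ProbabilityMeasure (Γ → Y))) :=
  IsEmbedding.subtypeVal

theorem BulletSim.tendsto_iff [Countable Γ] {ι : Type*} {l : Filter ι} {μ : ι → BulletSim Γ}
    {μ₀ : BulletSim Γ} : Tendsto μ l (𝓝 μ₀) ↔ ∀ f : C(Γ → Y, ℝ),
      Tendsto (fun i => ∫ y, f y ∂(μ i).toMeasure) l (𝓝 (∫ y, f y ∂μ₀.toMeasure)) := by
  rw [BulletSim.isEmbedding_val.tendsto_nhds_iff,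
    ProbabilityMeasure.tendsto_iff_forall_integral_tendsto]
  exact ⟨fun h f => h (BoundedContinuousFunction.mkOfCompact f), fun h f => h f.toContinuousMap⟩

theorem BulletSim.tendsto_of_law [Countable Γ] {Ω ι : Type*} [MeasurableSpace Ω] {P : Measure Ω}
    [IsProbabilityMeasure P] {l : Filter ι} {Φ : ι → Ω → Γ → Y} {Φ₀ : Ω → Γ → Y}
    (hΦ : ∀ i, Measurable (Φ i)) (hΦ₀ : Measurable Φ₀)
    (h : ∀ γ, ∀ δ > 0, Tendsto (fun i => P {ω | δ ≤ dist (Φ i ω γ) (Φ₀ ω γ)}) l (𝓝 0))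
    {μ : ι → BulletSim Γ} {μ₀ : BulletSim Γ} (hμ : ∀ i, (μ i).toMeasure = P.map (Φ i))
    (hμ₀ : μ₀.toMeasure = P.map Φ₀) : Tendsto μ l (𝓝 μ₀) := by
  rw [BulletSim.tendsto_iff]
  intro f
  rw [hμ₀, integral_map hΦ₀.aemeasurable f.continuous.aestronglyMeasurable]
  simp_rw [hμ, fun i => integral_map (hΦ i).aemeasurable
    (f.continuous.aestronglyMeasurable (μ := P.map (Φ i)))]
  exact tendsto_integral_comp hΦ hΦ₀ h f

/-! ### The map `E` is an embedding -/

theorem toMeasure_E [Countable Γ] (p : Adaptation × ActionSpace Γ) :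
    (E p).1.toMeasure = (volume : Measure Y).map (orbitMap p.1.1 p.2.out) := by
  obtain ⟨h, T⟩ := p
  conv_lhs => rw [← Quotient.out_eq T]
  rfl

theorem ActionSpace.tendsto_iff {ι : Type*} {l : Filter ι} {u : ι → ActionSpace Γ}
    {T : ActionSpace Γ} : Tendsto u l (𝓝 T) ↔ ∀ (γ : Γ) (A : Set Y), MeasurableSet A →
      Tendsto (fun i => (volume : Measure Y) (((u i).out.tr γ ⁻¹' A) ∆ (T.out.tr γ ⁻¹' A)))
        l (𝓝 0) := by
  rw [← MPAction.tendsto_iff, MPAction.isInducing_mk.tendsto_nhds_iff]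
  have h1 : (Quotient.mk (MPAction.aeSetoid Γ Y volume)) ∘ (fun i => (u i).out) = u :=
    funext fun i => Quotient.out_eq (u i)
  rw [h1, Quotient.out_eq]

theorem continuous_E [Countable Γ] : Continuous (E (Γ := Γ)) := by
  rw [continuous_iff_continuousAt]
  intro p
  change Tendsto E (𝓝 p) (𝓝 (E p))
  rw [tendsto_subtype_rng]
  refine BulletSim.tendsto_of_law (fun q => measurable_orbitMap q.1 q.2.out)
    (measurable_orbitMap p.1 p.2.out) (fun γ δ hδ => ?_) toMeasure_E (toMeasure_E p)
  have hT := ActionSpace.tendsto_iff.1 (continuous_snd.tendsto p) γ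
  have h1 := tendsto_measure_le_dist hT p.1.1.continuous (half_pos hδ)
  have h2 : ∀ᶠ q : Adaptation × ActionSpace Γ in 𝓝 p, ∀ y, dist (p.1.1 y) (q.1.1 y) < δ / 2 := by
    have h3 : Tendsto (fun q : Adaptation × ActionSpace Γ => q.1.1) (𝓝 p) (𝓝 p.1.1) :=
      (continuous_subtype_val.comp continuous_fst).tendsto p
    rw [ContinuousMap.tendsto_iff_tendstoUniformly, Metric.tendstoUniformly_iff] at h3
    exact h3 _ (half_pos hδ)
  refine tendsto_of_tendsto_of_tendsto_of_le_of_le' tendsto_const_nhds h1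
    (Eventually.of_forall fun _ => zero_le) ?_
  filter_upwards [h2] with q hq
  refine measure_mono fun y hy => ?_
  have h4 : δ ≤ dist (q.1.1 (q.2.out.tr γ y)) (p.1.1 (p.2.out.tr γ y)) := hy
  have h5 := hq (q.2.out.tr γ y)
  have h6 := dist_triangle_left (q.1.1 (q.2.out.tr γ y)) (p.1.1 (p.2.out.tr γ y))
    (p.1.1 (q.2.out.tr γ y))
  change δ / 2 ≤ dist (p.1.1 (q.2.out.tr γ y)) (p.1.1 (p.2.out.tr γ y))
  linarith

/-- Coarse convergence follows from strong convergence in `L¹` of continuous observables, which in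
turn is tested against continuous approximations `b` of `g ∘ S`. -/
theorem tendsto_symmDiff_of_integral {ι : Type*} {l : Filter ι} {P : Measure Y}
    [IsProbabilityMeasure P] {u : ι → Y → Y} {S : Y → Y} (hu : ∀ i, MeasurePreserving (u i) P P)
    (hS : MeasurePreserving S P P)
    (h : ∀ (g b : C(Y, ℝ)), Tendsto (fun i => ∫ y, |g (u i y) - b y| ∂P) l
      (𝓝 (∫ y, |g (S y) - b y| ∂P)))
    {A : Set Y} (hA : MeasurableSet A) :
    Tendsto (fun i => P ((u i ⁻¹' A) ∆ (S ⁻¹' A))) l (𝓝 0) := by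
  have hreal : Tendsto (fun i => P.real ((u i ⁻¹' A) ∆ (S ⁻¹' A))) l (𝓝 0) := by
    rw [Metric.tendsto_nhds]
    intro ε hε
    have hχ : Integrable (A.indicator (fun _ => (1 : ℝ))) P :=
      (integrable_const _).indicator hA
    obtain ⟨g, hg, hgi⟩ := hχ.exists_boundedContinuous_integral_sub_le
      (show 0 < ε / 5 by positivity)
    have hgS : Integrable (fun y => g (S y)) P := hS.integrable_comp_of_integrable hgi
    obtain ⟨b, hb, hbi⟩ := hgS.exists_boundedContinuous_integral_sub_le
      (show 0 < ε / 5 by positivity)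
    have hlim := h g.toContinuousMap b.toContinuousMap
    have hlt : ∫ y, |g.toContinuousMap (S y) - b.toContinuousMap y| ∂P < 2 * (ε / 5) :=
      lt_of_le_of_lt hb (by linarith)
    filter_upwards [hlim.eventually (gt_mem_nhds hlt)] with i hi
    change ∫ y, |g (u i y) - b y| ∂P < 2 * (ε / 5) at hi
    rw [Real.dist_eq, sub_zero, abs_of_nonneg measureReal_nonneg]
    set χ : Y → ℝ := A.indicator fun _ => (1 : ℝ) with hχd
    have hm : MeasurableSet ((u i ⁻¹' A) ∆ (S ⁻¹' A)) :=
      ((hu i).measurable hA).symmDiff (hS.measurable hA)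
    have hgu : Integrable (fun y => g (u i y)) P := (hu i).integrable_comp_of_integrable hgi
    have hD : Integrable (fun z => |χ z - g z|) P := (hχ.sub hgi).abs
    have hDu : Integrable (fun y => |χ (u i y) - g (u i y)|) P :=
      (hu i).integrable_comp_of_integrable hD
    have hDS : Integrable (fun y => |χ (S y) - g (S y)|) P := hS.integrable_comp_of_integrable hD
    have e1 : ∫ y, |χ (u i y) - g (u i y)| ∂P ≤ ε / 5 := by
      have := integral_map (μ := P) (hu i).measurable.aemeasurable
        (f := fun z => |χ z - g z|) (by rw [(hu i).map_eq]; exact hD.aestronglyMeasurable)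
      rw [(hu i).map_eq] at this
      rw [← this]
      exact hg
    have e2 : ∫ y, |χ (S y) - g (S y)| ∂P ≤ ε / 5 := by
      have := integral_map (μ := P) hS.measurable.aemeasurable
        (f := fun z => |χ z - g z|) (by rw [hS.map_eq]; exact hD.aestronglyMeasurable)
      rw [hS.map_eq] at this
      rw [← this]
      exact hg
    have e3 : ∫ y, |g (S y) - b y| ∂P ≤ ε / 5 := hb
    have i3 : Integrable (fun y => |g (u i y) - b y|) P := (hgu.sub hbi).abs
    have i4 : Integrable (fun y => |g (S y) - b y|) P := (hgS.sub hbi).abs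
    have hle : P.real ((u i ⁻¹' A) ∆ (S ⁻¹' A)) ≤
        ∫ y, (|χ (u i y) - g (u i y)| + |g (u i y) - b y| +
          (|g (S y) - b y| + |χ (S y) - g (S y)|)) ∂P := by
      rw [← integral_indicator_one hm]
      refine integral_mono ((integrable_const _).indicator hm) ((hDu.add i3).add (i4.add hDS))
        fun y => ?_
      have habs : ((u i ⁻¹' A) ∆ (S ⁻¹' A)).indicator (1 : Y → ℝ) y ≤ |χ (u i y) - χ (S y)| := by
        refine indicator_apply_le' (fun hy => ?_) (fun _ => abs_nonneg _)
        rcases hy with ⟨h1, h2⟩ | ⟨h1, h2⟩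
        · have h1' : u i y ∈ A := h1
          have h2' : S y ∉ A := h2
          simp [hχd, h1', h2']
        · have h1' : S y ∈ A := h1
          have h2' : u i y ∉ A := h2
          simp [hχd, h1', h2']
      refine habs.trans ?_
      have t1 := abs_sub_le (χ (u i y)) (g (u i y)) (χ (S y))
      have t2 := abs_sub_le (g (u i y)) (b y) (χ (S y))
      have t3 := abs_sub_le (b y) (g (S y)) (χ (S y))
      rw [abs_sub_comm (b y) (g (S y)), abs_sub_comm (g (S y)) (χ (S y))] at t3
      linarith
    have i12 : Integrable (fun y => |χ (u i y) - g (u i y)| + |g (u i y) - b y|) P := hDu.add i3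
    have i34 : Integrable (fun y => |g (S y) - b y| + |χ (S y) - g (S y)|) P := i4.add hDS
    rw [integral_add i12 i34, integral_add hDu i3, integral_add i4 hDS] at hle
    linarith
  have := ENNReal.tendsto_ofReal hreal
  simpa [measureReal_def, ENNReal.ofReal_toReal, measure_ne_top] using this

/-- Convergence of `E` forces convergence of both arguments: first of the adaptations, by their
marginals, and then of the actions, after transport by the inverse of the limit adaptation. -/
theorem tendsto_of_tendsto_E [Countable Γ] {ι : Type*} {l : Filter ι}
    {u : ι → Adaptation × ActionSpace Γ} {p : Adaptation × ActionSpace Γ}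
    (h : Tendsto (fun i => E (u i)) l (𝓝 (E p))) : Tendsto u l (𝓝 p) := by
  have hB : Tendsto (fun i => (E (u i)).1) l (𝓝 (E p).1) := tendsto_subtype_rng.1 h
  have hone : ∀ q : Adaptation × ActionSpace Γ,
      (volume : Measure Y).map q.1.1 = ((E q).1.toMeasure).map fun y => y 1 := by
    intro q
    rw [toMeasure_E, Measure.map_map (measurable_pi_apply 1) (measurable_orbitMap _ _)]
    congr 1
    funext y
    simp [orbitMap, q.2.out.tr_one]
  have hfst : Tendsto (fun i => (u i).1) l (𝓝 p.1) := by
    have hc : Continuous fun y : Γ → Y => y 1 := continuous_apply 1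
    have hP : Tendsto (fun i => (E (u i)).1.1) l (𝓝 (E p).1.1) :=
      BulletSim.isEmbedding_val.tendsto_nhds_iff.1 hB
    exact tendsto_adaptation (((ProbabilityMeasure.continuous_map hc).tendsto _).comp hP)
      (fun i => (hone (u i)).symm) (hone p).symm
  refine (nhds_prod_eq (x := p.1) (y := p.2)) ▸ hfst.prodMk ?_
  rw [ActionSpace.tendsto_iff]
  intro γ A hA
  refine tendsto_symmDiff_of_integral (fun i => (u i).2.out.mp γ) (p.2.out.mp γ) ?_ hA
  intro g b
  -- transport by the inverse of the limit adaptation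
  let H : Y ≃ₜ Y := p.1.2.1.homeomorph
  have hH : ∀ y, H.symm (p.1.1 y) = y := fun y => H.symm_apply_apply y
  let G : C(Y, ℝ) := g.comp ⟨H.symm, H.symm.continuous⟩
  let B : C(Y, ℝ) := b.comp ⟨H.symm, H.symm.continuous⟩
  have hG : ∀ y, G (p.1.1 y) = g y := fun y => congrArg g (hH y)
  have hB' : ∀ y, B (p.1.1 y) = b y := fun y => congrArg b (hH y)
  let F : C(Γ → Y, ℝ) := ⟨fun y => |G (y γ) - B (y 1)|, by fun_prop⟩
  have hF : ∀ q : Adaptation × ActionSpace Γ, ∫ y, F y ∂(E q).1.toMeasure =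
      ∫ y, |G (q.1.1 (q.2.out.tr γ y)) - B (q.1.1 y)| := by
    intro q
    rw [toMeasure_E, integral_map (measurable_orbitMap _ _).aemeasurable
      F.continuous.aestronglyMeasurable]
    refine integral_congr_ae (ae_of_all _ fun y => ?_)
    simp [F, orbitMap, q.2.out.tr_one]
  have hlim := BulletSim.tendsto_iff.1 hB F
  simp_rw [hF, hG, hB'] at hlim
  have hint : ∀ f f' k k' : Y → Y, Continuous f → Continuous f' → Measurable k → Measurable k' →
      ∀ g b : C(Y, ℝ), Integrable (fun y => |g (f (k y)) - b (f' (k' y))|)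
        (volume : Measure Y) := by
    intro f f' k k' hf hf' hk hk' g b
    have hi : ∀ (g : C(Y, ℝ)) (f k : Y → Y), Continuous f → Measurable k →
        Integrable (fun y => g (f (k y))) (volume : Measure Y) := fun g f k hf hk =>
      Integrable.of_bound ((g.continuous.comp hf).measurable.comp hk).aestronglyMeasurable ‖g‖
        (ae_of_all _ fun y => g.norm_coe_le_norm _)
    exact ((hi g f k hf hk).sub (hi b f' k' hf' hk')).abs
  have hdiff : Tendsto (fun i =>
      (∫ y, |g ((u i).2.out.tr γ y) - b y| ∂(volume : Measure Y)) -
      ∫ y, |G ((u i).1.1 ((u i).2.out.tr γ y)) - B ((u i).1.1 y)|) l (𝓝 0) := by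
    rw [Metric.tendsto_nhds]
    intro ε hε
    have hunif : ∀ K : C(Y, ℝ), ∀ᶠ i in l, ∀ y, |K (p.1.1 y) - K ((u i).1.1 y)| < ε / 4 := by
      intro K
      have hK : UniformContinuous K := CompactSpace.uniformContinuous_of_continuous K.continuous
      obtain ⟨δ, hδ, hδK⟩ := Metric.uniformContinuous_iff.1 hK (ε / 4) (by positivity)
      have h3 : Tendsto (fun i => (u i).1.1) l (𝓝 p.1.1) := tendsto_subtype_rng.1 hfst
      rw [ContinuousMap.tendsto_iff_tendstoUniformly, Metric.tendstoUniformly_iff] at h3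
      filter_upwards [h3 δ hδ] with i hi y
      exact hδK (hi y)
    filter_upwards [hunif G, hunif B] with i hi1 hi2
    have m1 : Measurable ((u i).2.out.tr γ) := ((u i).2.out.mp γ).measurable
    have I1 := hint id id _ id continuous_id continuous_id m1 measurable_id g b
    have I2 := hint _ _ _ id (u i).1.1.continuous (u i).1.1.continuous m1 measurable_id G B
    simp only [id_eq] at I1 I2
    rw [Real.dist_eq, sub_zero, ← integral_sub I1 I2]
    have : ∀ y, ‖|g ((u i).2.out.tr γ y) - b y| -
        |G ((u i).1.1 ((u i).2.out.tr γ y)) - B ((u i).1.1 y)|‖ ≤ ε / 2 := by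
      intro y
      have k1 := hi1 ((u i).2.out.tr γ y)
      have k2 := hi2 y
      rw [hG] at k1
      rw [hB'] at k2
      refine (abs_abs_sub_abs_le_abs_sub _ _).trans ?_
      rw [abs_le]
      rw [abs_lt] at k1 k2
      constructor <;> linarith
    have hn := norm_integral_le_of_norm_le_const (μ := (volume : Measure Y)) (ae_of_all _ this)
    simp only [measureReal_def, measure_univ, ENNReal.toReal_one, mul_one] at hn
    exact lt_of_le_of_lt hn (by linarith)
  have := hdiff.add hlim
  simpa using this

theorem isInducing_E [Countable Γ] : IsInducing (E (Γ := Γ)) := by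
  rw [isInducing_iff_nhds]
  intro p
  refine le_antisymm (continuous_E.tendsto p).le_comap ?_
  exact tendsto_of_tendsto_E (u := id) tendsto_comap

/-- Two actions that are topologically indistinguishable agree almost everywhere. -/
instance ActionSpace.t0Space : T0Space (ActionSpace Γ) := by
  refine ⟨fun S T hST => ?_⟩
  rw [← Quotient.out_eq S, ← Quotient.out_eq T]
  refine Quotient.sound fun γ => ?_
  have hlim : Tendsto (fun _ : Unit => S) (pure ()) (𝓝 T) := by
    rw [← hST.nhds_eq]
    exact tendsto_const_nhds
  have h0 : ∀ n : ℕ, (volume : Measure Y)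
      {y | 1 / ((n : ℝ) + 1) ≤ dist (S.out.tr γ y) (T.out.tr γ y)} = 0 := fun n =>
    tendsto_nhds_unique tendsto_const_nhds (tendsto_measure_le_dist
      (ActionSpace.tendsto_iff.1 hlim γ) continuous_id (Nat.one_div_pos_of_nat (n := n)))
  have h1 : ∀ᵐ y ∂(volume : Measure Y), ∀ n : ℕ,
      dist (S.out.tr γ y) (T.out.tr γ y) < 1 / ((n : ℝ) + 1) := by
    rw [ae_all_iff]
    intro n
    rw [ae_iff]
    simpa only [not_lt] using h0 n
  filter_upwards [h1] with y hy
  refine dist_le_zero.1 (le_of_forall_pos_le_add fun ε hε => ?_)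
  obtain ⟨n, hn⟩ := exists_nat_one_div_lt hε
  linarith [hy n]

theorem isEmbedding_E [Countable Γ] : IsEmbedding (E (Γ := Γ)) :=
  isInducing_E.isEmbedding

theorem measurable_eval {κ : Type*} (i : κ) : Measurable fun y : κ → Y => y i :=
  measurable_pi_apply i

/-! ### Graph-sims -/

theorem BulletSim.ext_toMeasure {μ ν : BulletSim Γ} (h : μ.toMeasure = ν.toMeasure) : μ = ν :=
  Subtype.ext (Subtype.ext h)

theorem BulletSim.measurePreserving_shift (μ : BulletSim Γ) (α : Γ) :
    MeasurePreserving (shift α) μ.toMeasure μ.toMeasure :=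
  ⟨measurable_shift α, μ.2 α⟩

instance BulletSim.isProbabilityMeasure_marg (μ : BulletSim Γ) : IsProbabilityMeasure μ.marg :=
  Measure.isProbabilityMeasure_map (measurable_eval (1 : Γ)).aemeasurable

theorem BulletSim.map_eval (μ : BulletSim Γ) (γ : Γ) :
    μ.toMeasure.map (fun y => y γ) = μ.marg := by
  have h : (fun y : Γ → Y => y γ) = (fun y => y 1) ∘ shift γ := by
    funext y
    simp [shift]
  rw [h, ← Measure.map_map (measurable_eval 1) (measurable_shift γ),
    (μ.measurePreserving_shift γ).map_eq]
  rfl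

/-- All coordinates of the sim are almost surely functions of the coordinate at the identity. -/
def BulletSim.IsGraph (μ : BulletSim Γ) : Prop :=
  ∀ γ : Γ, ∃ R : Y → Y, Measurable R ∧ ∀ᵐ y ∂μ.toMeasure, y γ = R (y 1)

theorem BulletSim.ae_shift (μ : BulletSim Γ) {γ : Γ} {R : Y → Y}
    (h : ∀ᵐ y ∂μ.toMeasure, y γ = R (y 1)) (α : Γ) :
    ∀ᵐ y ∂μ.toMeasure, y (γ * α) = R (y α) := by
  filter_upwards [(μ.measurePreserving_shift α).quasiMeasurePreserving.ae h] with y hy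
  simpa [shift] using hy

theorem BulletSim.measurePreserving_of_ae (μ : BulletSim Γ) {γ : Γ} {R : Y → Y}
    (hR : Measurable R) (h : ∀ᵐ y ∂μ.toMeasure, y γ = R (y 1)) :
    MeasurePreserving R μ.marg μ.marg := by
  refine ⟨hR, ?_⟩
  conv_lhs => rw [BulletSim.marg, Measure.map_map hR (measurable_eval 1)]
  rw [← μ.map_eval γ]
  exact Measure.map_congr (h.mono fun y hy => hy.symm)

/-- By shift invariance it suffices to compare every coordinate with the one at the identity: if
`y (β * α⁻¹) = R (y 1)` almost surely, then `y β = R (y α)` almost surely. -/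
theorem mem_graphSims_iff (μ : Sim Γ) : μ ∈ graphSims Γ ↔ μ.1.IsGraph := by
  constructor
  · intro h γ
    by_cases hγ : γ = 1
    · exact ⟨id, measurable_id, ae_of_all _ fun y => by rw [hγ, id]⟩
    obtain ⟨R, hR, hη⟩ := h 1 γ (Ne.symm hγ)
    refine ⟨R, hR.measurable, ?_⟩
    have hpair : Measurable fun y : Γ → Y => (y 1, y γ) :=
      (measurable_eval 1).prodMk (measurable_eval γ)
    have h1 : ∀ᵐ p ∂(μ.1.toMeasure.map fun y => (y 1, y γ)), p.2 = R p.1 := by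
      rw [hη]
      refine (ae_map_iff (measurable_id'.prodMk hR.measurable).aemeasurable
        (measurableSet_eq_fun measurable_snd (hR.measurable.comp measurable_fst))).2 ?_
      exact ae_of_all _ fun y => rfl
    exact ae_of_ae_map hpair.aemeasurable h1
  · intro h α β _
    obtain ⟨R, hR, hae⟩ := h (β * α⁻¹)
    refine ⟨R, μ.1.measurePreserving_of_ae hR hae, ?_⟩
    have h1 := μ.1.ae_shift hae α
    rw [inv_mul_cancel_right] at h1
    rw [← μ.1.map_eval α, Measure.map_map (measurable_id'.prodMk hR) (measurable_eval α)]
    refine Measure.map_congr ?_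
    filter_upwards [h1] with y hy
    simp [hy]

/-- The homeomorphism of the circle underlying an adaptation. -/
noncomputable def Adaptation.toHomeomorph (h : Adaptation) : Y ≃ₜ Y := h.2.1.homeomorph

theorem Adaptation.symm_apply (h : Adaptation) (y : Y) : h.toHomeomorph.symm (h.1 y) = y :=
  h.toHomeomorph.symm_apply_apply y

theorem Adaptation.apply_symm (h : Adaptation) (y : Y) : h.1 (h.toHomeomorph.symm y) = y :=
  h.toHomeomorph.apply_symm_apply y

theorem Adaptation.measurable_symm (h : Adaptation) : Measurable h.toHomeomorph.symm :=
  h.toHomeomorph.symm.continuous.measurable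

section Countable

variable [Countable Γ]

theorem isGraph_E (p : Adaptation × ActionSpace Γ) : (E p).1.IsGraph := by
  intro γ
  have hR : Measurable (p.1.1 ∘ p.2.out.tr γ ∘ p.1.toHomeomorph.symm) :=
    p.1.1.continuous.measurable.comp ((p.2.out.mp γ).measurable.comp p.1.measurable_symm)
  refine ⟨_, hR, ?_⟩
  rw [toMeasure_E]
  refine (ae_map_iff (measurable_orbitMap _ _).aemeasurable
    (measurableSet_eq_fun (measurable_eval γ) (hR.comp (measurable_eval 1)))).2 ?_
  refine ae_of_all _ fun y => ?_
  simp [orbitMap, p.2.out.tr_one, Adaptation.symm_apply]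

/-- A good sim with the graph property comes from an adaptation and an action: the adaptation is
read off the marginal, and the maps expressing the coordinates through each other form an action
almost everywhere. -/
theorem exists_E_eq {μ : Sim Γ} (hμ : μ.1.IsGraph) : ∃ p, E p = μ := by
  choose R hRm hR using hμ
  obtain ⟨h, hh⟩ := exists_adaptation_map_eq μ.2
  have hRmp : ∀ γ, MeasurePreserving (R γ) μ.1.marg μ.1.marg := fun γ =>
    μ.1.measurePreserving_of_ae (hRm γ) (hR γ)
  have hmp : MeasurePreserving h.1 volume μ.1.marg := ⟨h.1.continuous.measurable, hh⟩
  have hmp' : MeasurePreserving h.toHomeomorph.symm μ.1.marg volume := by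
    refine ⟨h.measurable_symm, ?_⟩
    rw [← hh, Measure.map_map h.measurable_symm hmp.measurable]
    have : h.toHomeomorph.symm ∘ h.1 = id := funext h.symm_apply
    rw [this, Measure.map_id]
  have h1 : R 1 =ᵐ[μ.1.marg] id := by
    change ∀ᵐ y ∂μ.1.marg, R 1 y = y
    refine (ae_map_iff (measurable_eval (1 : Γ)).aemeasurable
      (measurableSet_eq_fun (hRm 1) measurable_id')).2 ?_
    filter_upwards [hR 1] with y hy using hy.symm
  have hmul : ∀ β α, R (β * α) =ᵐ[μ.1.marg] R β ∘ R α := by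
    intro β α
    change ∀ᵐ y ∂μ.1.marg, R (β * α) y = R β (R α y)
    refine (ae_map_iff (measurable_eval (1 : Γ)).aemeasurable
      (measurableSet_eq_fun (hRm _) ((hRm β).comp (hRm α)))).2 ?_
    filter_upwards [hR α, hR (β * α), μ.1.ae_shift (hR β) α] with y e1 e2 e3
    rw [Function.comp_apply, ← e1, ← e2, e3]
  obtain ⟨T, hT⟩ := exists_mpAction_ae_eq (μ := (volume : Measure Y))
    (fun γ => h.toHomeomorph.symm ∘ R γ ∘ h.1) (fun γ => hmp'.comp ((hRmp γ).comp hmp))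
    (by
      filter_upwards [hmp.quasiMeasurePreserving.ae h1] with y hy
      simp only [Function.comp_apply, hy, id, h.symm_apply])
    (fun β α => by
      filter_upwards [hmp.quasiMeasurePreserving.ae (hmul β α)] with y hy
      simp only [Function.comp_apply] at hy
      simp only [Function.comp_apply, hy, h.apply_symm])
  have hprod : Measurable fun (z : Y) (γ : Γ) => R γ z := measurable_pi_lambda _ hRm
  refine ⟨(h, Quotient.mk _ T), Subtype.ext (BulletSim.ext_toMeasure ?_)⟩
  calc (volume : Measure Y).map (orbitMap h.1 T)
      = (volume : Measure Y).map ((fun z γ => R γ z) ∘ h.1) := by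
        refine Measure.map_congr ?_
        filter_upwards [ae_all_iff.2 hT] with y hy
        funext γ
        simp only [orbitMap, hy γ, Function.comp_apply, h.apply_symm]
    _ = μ.1.toMeasure.map ((fun z γ => R γ z) ∘ fun y => y 1) := by
        rw [← Measure.map_map hprod hmp.measurable, hmp.map_eq, BulletSim.marg,
          Measure.map_map hprod (measurable_eval 1)]
    _ = μ.1.toMeasure.map id := by
        refine Measure.map_congr ?_
        filter_upwards [ae_all_iff.2 hR] with y hy
        funext γ
        exact (hy γ).symm
    _ = μ.1.toMeasure := Measure.map_id

theorem range_E : range (E (Γ := Γ)) = graphSims Γ := by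
  ext μ
  rw [mem_graphSims_iff]
  constructor
  · rintro ⟨p, rfl⟩
    exact isGraph_E p
  · exact fun h => exists_E_eq h

/-- The isomorphism is the orbit map, with inverse `y ↦ h⁻¹ (y 1)`. -/
theorem isom_E (h : Adaptation) (T : ActionSpace Γ) :
    Isom (E (h, T)).1.system ((actionSetting Γ).sys T) := by
  have hψ : Measurable (orbitMap h.1 T.out) := measurable_orbitMap h T.out
  have hφ : Measurable fun y : Γ → Y => h.toHomeomorph.symm (y 1) :=
    h.measurable_symm.comp (measurable_eval 1)
  have hφψ : ∀ y, h.toHomeomorph.symm (orbitMap h.1 T.out y 1) = y := fun y => by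
    simp [orbitMap, T.out.tr_one, h.symm_apply]
  have hE : (E (h, T)).1.toMeasure = volume.map (orbitMap h.1 T.out) := toMeasure_E (h, T)
  refine Isom.symm ⟨orbitMap h.1 T.out, fun y => h.toHomeomorph.symm (y 1), ⟨hψ, hE.symm⟩,
    ⟨hφ, ?_⟩, ae_of_all _ hφψ, ?_, fun γ => ae_of_all _ fun y => ?_⟩
  · change (E (h, T)).1.toMeasure.map (fun y : Γ → Y => h.toHomeomorph.symm (y 1)) = volume
    rw [hE, Measure.map_map hφ hψ]
    exact (congrArg (Measure.map · volume) (funext hφψ)).trans Measure.map_id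
  · change ∀ᵐ y ∂(E (h, T)).1.toMeasure, orbitMap h.1 T.out (h.toHomeomorph.symm (y 1)) = y
    rw [hE]
    refine (ae_map_iff hψ.aemeasurable
      (measurableSet_eq_fun (hψ.comp hφ) measurable_id')).2 ?_
    exact ae_of_all _ fun y => congrArg _ (hφψ y)
  · funext β
    change h.1 (T.out.tr β (T.out.tr γ y)) = h.1 (T.out.tr (β * γ) y)
    rw [T.out.tr_mul]
    rfl

end Countable

/-! ### The space of sims is compact and metrizable -/

theorem continuous_shift (α : Γ) : Continuous (shift α) :=
  continuous_pi fun γ => continuous_apply (γ * α)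

instance BulletSim.metrizableSpace [Countable Γ] : TopologicalSpace.MetrizableSpace (BulletSim Γ) :=
  BulletSim.isEmbedding_val.metrizableSpace

instance BulletSim.compactSpace [Countable Γ] : CompactSpace (BulletSim Γ) := by
  have hc : IsClosed {μ : ProbabilityMeasure (Γ → Y) |
      ∀ α : Γ, (μ : Measure (Γ → Y)).map (shift α) = μ} := by
    have : {μ : ProbabilityMeasure (Γ → Y) | ∀ α : Γ, (μ : Measure (Γ → Y)).map (shift α) = μ} =
        ⋂ α : Γ, {μ | μ.map (measurable_shift α).aemeasurable = μ} := by
      ext μ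
      simp only [mem_ofPred_eq, mem_iInter, ← ProbabilityMeasure.toMeasure_injective.eq_iff,
        ProbabilityMeasure.toMeasure_map]
    rw [this]
    exact isClosed_iInter fun α =>
      isClosed_eq (ProbabilityMeasure.continuous_map (continuous_shift α)) continuous_id
  exact isCompact_iff_compactSpace.1 hc.isCompact

instance BulletSim.secondCountableTopology [Countable Γ] :
    SecondCountableTopology (BulletSim Γ) := by
  let := TopologicalSpace.metrizableSpaceMetric (BulletSim Γ)
  infer_instance

/-- The identity of the circle as an adaptation. -/
def Adaptation.refl : Adaptation := ⟨ContinuousMap.id Y, IsHomeomorph.id, rfl, fun _ _ h => h⟩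

instance ActionSpace.secondCountableTopology [Countable Γ] :
    SecondCountableTopology (ActionSpace Γ) := by
  have h : IsInducing fun T : ActionSpace Γ => (E (Adaptation.refl, T)).1 :=
    IsInducing.subtypeVal.comp
      (isInducing_E.comp (isEmbedding_prodMkRight Adaptation.refl).isInducing)
  exact h.secondCountableTopology

/-! ### Open conditions cutting out the graph-sims -/

theorem isOpen_measure_closed_lt {F : Set Y} (hF : IsClosed F) (a : ENNReal) :
    IsOpen {ν : ProbabilityMeasure Y | (ν : Measure Y) F < a} := by
  rw [isOpen_iff_mem_nhds]
  intro ν hν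
  exact eventually_lt_of_limsup_lt
    ((ProbabilityMeasure.limsup_measure_closed_le_of_tendsto tendsto_id hF).trans_lt hν)

theorem isOpen_lt_measure_open {U : Set Y} (hU : IsOpen U) (a : ENNReal) :
    IsOpen {ν : ProbabilityMeasure Y | a < (ν : Measure Y) U} := by
  rw [isOpen_iff_mem_nhds]
  intro ν hν
  exact eventually_lt_of_lt_liminf
    (lt_of_lt_of_le hν (ProbabilityMeasure.le_liminf_measure_open_of_tendsto tendsto_id hU))

theorem exists_continuous_marg [Countable Γ] :
    ∃ m : BulletSim Γ → ProbabilityMeasure Y, Continuous m ∧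
      ∀ μ, (m μ : Measure Y) = μ.marg :=
  ⟨fun μ => μ.1.map (measurable_eval (1 : Γ)).aemeasurable,
    (ProbabilityMeasure.continuous_map (continuous_apply (1 : Γ))).comp
      BulletSim.isEmbedding_val.continuous, fun _ => rfl⟩

/-- The sims for which the circle is covered by finitely many closed balls of marginal measure less
than `ε`. -/
def smallAtoms (Γ : Type) [Group Γ] (ε : ENNReal) : Set (BulletSim Γ) :=
  {μ | ∃ (t : Finset Y) (r : Y → ℝ), (∀ x ∈ t, μ.marg (Metric.closedBall x (r x)) < ε) ∧
    ⋃ x ∈ t, Metric.closedBall x (r x) = univ}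

theorem isOpen_smallAtoms [Countable Γ] (ε : ENNReal) : IsOpen (smallAtoms Γ ε) := by
  obtain ⟨m, hm, hmμ⟩ := exists_continuous_marg (Γ := Γ)
  have : smallAtoms Γ ε = ⋃ t : Finset Y, ⋃ r : Y → ℝ,
      ⋃ _ : ⋃ x ∈ t, Metric.closedBall x (r x) = univ,
        ⋂ x ∈ t, m ⁻¹' {ν | (ν : Measure Y) (Metric.closedBall x (r x)) < ε} := by
    ext μ
    simp only [smallAtoms, mem_ofPred_eq, mem_iUnion, mem_iInter, mem_preimage, hmμ, exists_prop]
    simp only [and_comm]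
  rw [this]
  refine isOpen_iUnion fun t => isOpen_iUnion fun r => isOpen_iUnion fun _ =>
    isOpen_biInter_finset fun x _ =>
      (isOpen_measure_closed_lt Metric.isClosed_closedBall _).preimage hm

theorem measure_singleton_lt_of_mem_smallAtoms {μ : BulletSim Γ} {ε : ENNReal}
    (h : μ ∈ smallAtoms Γ ε) (y : Y) : μ.marg {y} < ε := by
  obtain ⟨t, r, ht, hcov⟩ := h
  obtain ⟨x, hx, hy⟩ := mem_iUnion₂.1 (hcov.symm ▸ mem_univ y)
  exact (measure_mono (singleton_subset_iff.2 hy)).trans_lt (ht x hx)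

/-- Each point has a closed ball of measure less than `ε` around it, and finitely many of these balls
cover the circle by compactness. -/
theorem mem_smallAtoms {μ : BulletSim Γ} (h : ∀ y, μ.marg {y} = 0) {ε : ENNReal} (hε : 0 < ε) :
    μ ∈ smallAtoms Γ ε := by
  have h1 : ∀ y : Y, ∃ r : ℝ, 0 < r ∧ μ.marg (Metric.closedBall y r) < ε := by
    intro y
    have hlim := tendsto_measure_cthickening_of_isClosed (μ := μ.marg) (s := {y})
      ⟨1, one_pos, measure_ne_top _ _⟩ isClosed_singleton
    rw [h y] at hlim
    have h2 : ∀ᶠ r : ℝ in 𝓝[>] 0, μ.marg (Metric.cthickening r {y}) < ε :=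
      (hlim.mono_left nhdsWithin_le_nhds).eventually (gt_mem_nhds hε)
    obtain ⟨r, hr, hr0⟩ := (h2.and self_mem_nhdsWithin).exists
    refine ⟨r, hr0, ?_⟩
    rwa [Metric.cthickening_singleton _ (le_of_lt hr0)] at hr
  choose r hr0 hr using h1
  obtain ⟨t, -, ht⟩ := isCompact_univ.elim_nhds_subcover (fun y => Metric.closedBall y (r y))
    fun y _ => Metric.closedBall_mem_nhds y (hr0 y)
  exact ⟨t, r, fun x _ => hr x, univ_subset_iff.1 ht⟩

/-- The standard embedding of the circle into the complex plane. -/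
noncomputable def circleEmbedding : C(Y, ℂ) :=
  ⟨fun y => (AddCircle.toCircle y : ℂ), by fun_prop⟩

theorem circleEmbedding_injective : Function.Injective circleEmbedding := fun _ _ h =>
  AddCircle.injective_toCircle one_ne_zero (Subtype.ext h)

/-- The sims for which the coordinate at `γ` is within `ε` in mean of some continuous function of
the coordinate at the identity. -/
def nearGraph (γ : Γ) (ε : ℝ) : Set (BulletSim Γ) :=
  {μ | ∃ g : C(Y, ℂ), ∫ y, ‖circleEmbedding (y γ) - g (y 1)‖ ∂μ.toMeasure < ε}

theorem isOpen_nearGraph [Countable Γ] (γ : Γ) (ε : ℝ) : IsOpen (nearGraph γ ε) := by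
  have : nearGraph γ ε = ⋃ g : C(Y, ℂ),
      {μ | ∫ y, ‖circleEmbedding (y γ) - g (y 1)‖ ∂μ.toMeasure < ε} := by
    ext μ
    simp [nearGraph]
  rw [this]
  refine isOpen_iUnion fun g => isOpen_lt ?_ continuous_const
  let F : C(Γ → Y, ℝ) := ⟨fun y => ‖circleEmbedding (y γ) - g (y 1)‖, by fun_prop⟩
  exact continuous_iff_continuousAt.2 fun μ => BulletSim.tendsto_iff.1 tendsto_id F

theorem BulletSim.IsGraph.mem_nearGraph {μ : BulletSim Γ} (h : μ.IsGraph) (γ : Γ) {ε : ℝ}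
    (hε : 0 < ε) : μ ∈ nearGraph γ ε := by
  obtain ⟨R, hRm, hR⟩ := h γ
  have hi : Integrable (fun y => circleEmbedding (R y)) μ.marg :=
    Integrable.of_bound (circleEmbedding.continuous.measurable.comp hRm).aestronglyMeasurable
      ‖circleEmbedding‖ (ae_of_all _ fun y => circleEmbedding.norm_coe_le_norm _)
  obtain ⟨g, hg, -⟩ := hi.exists_boundedContinuous_integral_sub_le (half_pos hε)
  refine ⟨g.toContinuousMap, lt_of_eq_of_lt ?_ (hg.trans_lt (half_lt_self hε))⟩
  have hm : Measurable fun x => ‖circleEmbedding (R x) - g x‖ :=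
    ((circleEmbedding.continuous.measurable.comp hRm).sub g.continuous.measurable).norm
  rw [BulletSim.marg, integral_map (measurable_eval 1).aemeasurable hm.aestronglyMeasurable]
  refine integral_congr_ae ?_
  filter_upwards [hR] with y hy
  rw [hy]
  rfl

/-- Continuous functions of `y 1` which converge to `y γ` in mean converge almost surely along a
subsequence, so that `y γ` is itself a measurable function of `y 1`. -/
theorem exists_ae_eq_of_mem_nearGraph [Countable Γ] {μ : BulletSim Γ} {γ : Γ}
    (h : ∀ n : ℕ, μ ∈ nearGraph γ (1 / ((n : ℝ) + 1))) :
    ∃ R : Y → Y, Measurable R ∧ ∀ᵐ y ∂μ.toMeasure, y γ = R (y 1) := by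
  choose g hg using h
  have hgm : ∀ n, Measurable fun y : Γ → Y => g n (y 1) := fun n =>
    (g n).continuous.measurable.comp (measurable_eval 1)
  have hcm : Measurable fun y : Γ → Y => circleEmbedding (y γ) :=
    circleEmbedding.continuous.measurable.comp (measurable_eval γ)
  have hmeas : TendstoInMeasure μ.toMeasure (fun n y => g n (y 1)) atTop
      (fun y => circleEmbedding (y γ)) := by
    refine tendstoInMeasure_of_tendsto_eLpNorm one_ne_zero
      (fun n => (hgm n).aestronglyMeasurable) hcm.aestronglyMeasurable ?_
    have hlim : Tendsto (fun n : ℕ => ENNReal.ofReal (1 / ((n : ℝ) + 1))) atTop (𝓝 0) := by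
      simpa using ENNReal.tendsto_ofReal tendsto_one_div_add_atTop_nhds_zero_nat
    refine tendsto_of_tendsto_of_tendsto_of_le_of_le tendsto_const_nhds hlim (fun _ => zero_le)
      fun n => ?_
    have hi : Integrable (fun y : Γ → Y => g n (y 1) - circleEmbedding (y γ)) μ.toMeasure := by
      refine Integrable.sub ?_ ?_
      · exact Integrable.of_bound (hgm n).aestronglyMeasurable ‖g n‖
          (ae_of_all _ fun y => (g n).norm_coe_le_norm _)
      · exact Integrable.of_bound hcm.aestronglyMeasurable ‖circleEmbedding‖
          (ae_of_all _ fun y => circleEmbedding.norm_coe_le_norm _)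
    rw [eLpNorm_one_eq_lintegral_enorm]
    change ∫⁻ y, ‖g n (y 1) - circleEmbedding (y γ)‖ₑ ∂μ.toMeasure ≤ _
    rw [← ofReal_integral_norm_eq_lintegral_enorm hi]
    refine ENNReal.ofReal_le_ofReal ?_
    simp_rw [norm_sub_rev (g n _)]
    exact (hg n).le
  obtain ⟨ns, -, hns⟩ := hmeas.exists_seq_tendsto_ae
  have hex : ∀ᵐ z ∂μ.marg, ∃ c : ℂ, Tendsto (fun i => g (ns i) z) atTop (𝓝 c) := by
    refine (ae_map_iff (measurable_eval (1 : Γ)).aemeasurable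
      (MeasureTheory.measurableSet_exists_tendsto
        fun i => (g (ns i)).continuous.measurable)).2 ?_
    filter_upwards [hns] with y hy using ⟨_, hy⟩
  obtain ⟨G, hGm, hG⟩ := measurable_limit_of_tendsto_metrizable_ae
    (fun i => (g (ns i)).continuous.measurable.aemeasurable) hex
  have hce : MeasurableEmbedding circleEmbedding :=
    circleEmbedding.continuous.measurable.measurableEmbedding circleEmbedding_injective
  obtain ⟨r, hrm, hr⟩ := hce.exists_measurable_extend measurable_id fun _ => ⟨(0 : Y)⟩
  refine ⟨r ∘ G, hrm.comp hGm, ?_⟩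
  filter_upwards [hns, ae_of_ae_map (measurable_eval (1 : Γ)).aemeasurable hG] with y h1 h2
  rw [Function.comp_apply, ← tendsto_nhds_unique h1 h2]
  exact (congrFun hr (y γ)).symm

/-! ### Density of the graph-sims -/

/-- Every measurable map from a standard Borel space to the circle is a uniform limit of injective
ones: keep the first digit of the value in a large base, and let the remaining digits
encode the point. -/
theorem exists_injective_near {X : Type*} [MeasurableSpace X] [StandardBorelSpace X] {p : X → Y}
    (hp : Measurable p) {δ : ℝ} (hδ : 0 < δ) :
    ∃ q : X → Y, Measurable q ∧ Function.Injective q ∧ ∀ x, dist (q x) (p x) < δ := by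
  obtain ⟨f, hf⟩ := exists_measurableEmbedding_real X
  obtain ⟨k, hk⟩ := exists_nat_gt (1 / δ)
  have hk0 : (0 : ℝ) < k := (one_div_pos.2 hδ).trans hk
  let c : X → ℝ := fun x => Real.arctan (f x) / Real.pi + 1 / 2
  have hc0 : ∀ x, 0 < c x := fun x => by
    have h1 := Real.neg_pi_div_two_lt_arctan (f x)
    have h2 : -(1 / 2) < Real.arctan (f x) / Real.pi := by
      rw [lt_div_iff₀ Real.pi_pos]
      linarith
    simp only [c]
    linarith
  have hc1 : ∀ x, c x < 1 := fun x => by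
    have h1 := Real.arctan_lt_pi_div_two (f x)
    have h2 : Real.arctan (f x) / Real.pi < 1 / 2 := by
      rw [div_lt_iff₀ Real.pi_pos]
      linarith
    simp only [c]
    linarith
  have hcinj : Function.Injective c := fun x y hxy => by
    have h1 : Real.arctan (f x) / Real.pi = Real.arctan (f y) / Real.pi := by
      simp only [c] at hxy
      linarith
    exact hf.injective (Real.arctan_injective ((div_left_inj' Real.pi_pos.ne').1 h1))
  have hcm : Measurable c := ((Real.measurable_arctan.comp hf.measurable).div_const _).add_const _
  let d : X → ℝ := fun x => ((⌊k * coord (p x)⌋₊ : ℝ) + c x) / k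
  have hfl : ∀ x, (⌊k * coord (p x)⌋₊ : ℝ) ≤ k * coord (p x) := fun x =>
    Nat.floor_le (mul_nonneg hk0.le (coord_mem _).1)
  have hfl' : ∀ x, k * coord (p x) < (⌊k * coord (p x)⌋₊ : ℝ) + 1 := fun x => Nat.lt_floor_add_one _
  have hd : ∀ x, d x ∈ Ico (0 : ℝ) 1 := fun x => by
    refine ⟨div_nonneg (add_nonneg (Nat.cast_nonneg _) (hc0 x).le) hk0.le, ?_⟩
    rw [div_lt_one hk0]
    have h1 : (⌊k * coord (p x)⌋₊ : ℝ) < k :=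
      (hfl x).trans_lt (mul_lt_of_lt_one_right hk0 (coord_mem _).2)
    have h2 : ((⌊k * coord (p x)⌋₊ : ℕ) : ℝ) + 1 ≤ k := by exact_mod_cast h1
    have h3 := hc1 x
    linarith
  refine ⟨fun x => (d x : Y), ?_, fun x y hxy => hcinj ?_, fun x => ?_⟩
  · refine AddCircle.measurable_mk'.comp (Measurable.div_const (Measurable.add ?_ hcm) _)
    exact (measurable_from_nat.comp
      (Nat.measurable_floor.comp (measurable_const.mul (measurable_coord.comp hp))))
  · have h1 : d x = d y := by
      rw [← coord_coe (hd x), ← coord_coe (hd y)]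
      exact congrArg coord hxy
    have h2 : (⌊k * coord (p x)⌋₊ : ℝ) + c x = (⌊k * coord (p y)⌋₊ : ℝ) + c y :=
      (div_left_inj' hk0.ne').1 h1
    have h3 : ∀ (n : ℕ) (x : X), ⌊(n : ℝ) + c x⌋₊ = n := fun n x => by
      rw [Nat.floor_eq_iff (add_nonneg (Nat.cast_nonneg _) (hc0 x).le)]
      exact ⟨by linarith [hc0 x], by linarith [hc1 x]⟩
    have h4 : ⌊k * coord (p x)⌋₊ = ⌊k * coord (p y)⌋₊ := by
      rw [← h3 ⌊k * coord (p x)⌋₊ x, h2, h3]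
    rw [h4] at h2
    linarith
  · have h1 : dist ((d x : ℝ) : Y) (p x) ≤ |d x - coord (p x)| := by
      conv_lhs => rw [← coe_coord (p x)]
      exact dist_coe_le _ _
    refine h1.trans_lt ?_
    have h2 : d x - coord (p x) = ((⌊k * coord (p x)⌋₊ : ℝ) + c x - k * coord (p x)) / k := by
      simp only [d]
      field_simp
    have h3 : |(⌊k * coord (p x)⌋₊ : ℝ) + c x - k * coord (p x)| ≤ 1 := by
      rw [abs_le]
      constructor <;> linarith [hfl x, hfl' x, hc0 x, hc1 x]
    rw [h2, abs_div, abs_of_pos hk0, div_lt_iff₀ hk0]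
    rw [div_lt_iff₀ hδ] at hk
    linarith

section Factor

variable {X : Type} [MeasurableSpace X] {P : Measure X}

theorem measurable_observe (S : MPAction Γ X P) {q : X → Y} (hq : Measurable q) :
    Measurable fun (x : X) (γ : Γ) => q (S.tr γ x) :=
  measurable_pi_lambda _ fun γ => hq.comp (S.mp γ).measurable

variable [IsProbabilityMeasure P]

/-- The law of the process `(q (S^γ x))_γ` obtained by observing the action `S` through `q`. -/
noncomputable def observe (S : MPAction Γ X P) {q : X → Y} (hq : Measurable q) : BulletSim Γ :=
  ⟨⟨P.map fun x γ => q (S.tr γ x),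
    Measure.isProbabilityMeasure_map (measurable_observe S hq).aemeasurable⟩, fun α => by
    change (P.map fun x γ => q (S.tr γ x)).map (shift α) = P.map fun x γ => q (S.tr γ x)
    have e : shift α ∘ (fun x γ => q (S.tr γ x)) = (fun x γ => q (S.tr γ x)) ∘ S.tr α := by
      funext x γ
      simp [shift, S.tr_mul]
    rw [Measure.map_map (measurable_shift α) (measurable_observe S hq), e,
      ← Measure.map_map (measurable_observe S hq) (S.mp α).measurable, (S.mp α).map_eq]⟩

theorem toMeasure_observe (S : MPAction Γ X P) {q : X → Y} (hq : Measurable q) :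
    (observe S hq).toMeasure = P.map fun x γ => q (S.tr γ x) := rfl

theorem marg_observe (S : MPAction Γ X P) {q : X → Y} (hq : Measurable q) :
    (observe S hq).marg = P.map q := by
  rw [BulletSim.marg, toMeasure_observe,
    Measure.map_map (measurable_eval 1) (measurable_observe S hq)]
  congr 1
  funext x
  simp [S.tr_one]

/-- An injective observation determines the point, hence the whole orbit. -/
theorem isGraph_observe [Countable Γ] [StandardBorelSpace X] (S : MPAction Γ X P) {q : X → Y}
    (hq : Measurable q) (hinj : Function.Injective q) : (observe S hq).IsGraph := by
  have : Nonempty X := P.nonempty_of_neZero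
  obtain ⟨r, hrm, hr⟩ := (hq.measurableEmbedding hinj).exists_measurable_extend measurable_id
    fun _ => inferInstance
  intro γ
  have hR : Measurable (q ∘ S.tr γ ∘ r) := hq.comp ((S.mp γ).measurable.comp hrm)
  refine ⟨_, hR, ?_⟩
  rw [toMeasure_observe]
  refine (ae_map_iff (measurable_observe S hq).aemeasurable
    (measurableSet_eq_fun (measurable_eval γ) (hR.comp (measurable_eval 1)))).2 ?_
  refine ae_of_all _ fun x => ?_
  have hx : r (q x) = x := congrFun hr x
  simp [S.tr_one, hx]

theorem marg_observe_singleton [NullSingletonClass P] (S : MPAction Γ X P) {q : X → Y}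
    (hq : Measurable q) (hinj : Function.Injective q) (y : Y) : (observe S hq).marg {y} = 0 := by
  rw [marg_observe, Measure.map_apply hq (measurableSet_singleton y)]
  exact (Set.subsingleton_singleton.preimage hinj).measure_zero P

end Factor

instance Y.standardBorelSpace : StandardBorelSpace Y := inferInstance

/-- The product of the shift with the identity of the circle. The second factor removes atoms. -/
noncomputable def inflate (μ : BulletSim Γ) :
    MPAction Γ ((Γ → Y) × Y) (μ.toMeasure.prod (volume : Measure Y)) where
  tr γ := Prod.map (shift γ) id
  tr_one := by
    funext x
    refine Prod.ext (funext fun γ => ?_) rfl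
    simp [shift]
  tr_mul β α := by
    funext x
    refine Prod.ext (funext fun γ => ?_) rfl
    simp [shift, mul_assoc]
  mp γ := (μ.measurePreserving_shift γ).prod (MeasurePreserving.id _)

/-- The convex combination of two sims. -/
noncomputable def mix (t : ℝ) (ht : t ∈ Icc (0 : ℝ) 1) (μ ν : BulletSim Γ) : BulletSim Γ :=
  ⟨⟨ENNReal.ofReal (1 - t) • μ.toMeasure + ENNReal.ofReal t • ν.toMeasure, ⟨by
    simp only [Measure.add_apply, Measure.smul_apply, measure_univ, smul_eq_mul, mul_one]
    rw [← ENNReal.ofReal_add (sub_nonneg.2 ht.2) ht.1]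
    simp⟩⟩, fun α => by
    change (ENNReal.ofReal (1 - t) • μ.toMeasure + ENNReal.ofReal t • ν.toMeasure).map (shift α) =
      ENNReal.ofReal (1 - t) • μ.toMeasure + ENNReal.ofReal t • ν.toMeasure
    rw [Measure.map_add _ _ (measurable_shift α), Measure.map_smul, Measure.map_smul,
      (μ.measurePreserving_shift α).map_eq, (ν.measurePreserving_shift α).map_eq]⟩

theorem toMeasure_mix (t : ℝ) (ht : t ∈ Icc (0 : ℝ) 1) (μ ν : BulletSim Γ) :
    (mix t ht μ ν).toMeasure =
      ENNReal.ofReal (1 - t) • μ.toMeasure + ENNReal.ofReal t • ν.toMeasure := rfl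

section Countable

variable [Countable Γ]

theorem dense_isGraph : Dense {μ : BulletSim Γ | (∀ y, μ.marg {y} = 0) ∧ μ.IsGraph} := by
  intro μ
  have hp : Measurable fun x : (Γ → Y) × Y => x.1 1 := (measurable_eval 1).comp measurable_fst
  choose q hqm hqi hqd using fun n : ℕ =>
    exists_injective_near hp (δ := 1 / ((n : ℝ) + 1)) Nat.one_div_pos_of_nat
  refine mem_closure_of_tendsto (f := fun n => observe (inflate μ) (hqm n)) (b := atTop) ?_
    (Eventually.of_forall fun n => ⟨marg_observe_singleton _ _ (hqi n),
      isGraph_observe _ _ (hqi n)⟩)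
  refine BulletSim.tendsto_of_law (Φ₀ := fun x : (Γ → Y) × Y => x.1)
    (fun n => measurable_observe (inflate μ) (hqm n)) measurable_fst (fun γ δ hδ => ?_)
    (fun n => toMeasure_observe _ _) ?_
  · refine tendsto_const_nhds.congr' ?_
    filter_upwards [tendsto_one_div_add_atTop_nhds_zero_nat.eventually (gt_mem_nhds hδ)] with n hn
    have hempty : {x : (Γ → Y) × Y | δ ≤ dist (q n ((inflate μ).tr γ x)) (x.1 γ)} = ∅ := by
      refine eq_empty_of_forall_notMem fun x hx => ?_
      have h1 : dist (q n ((inflate μ).tr γ x)) (x.1 (1 * γ)) < 1 / ((n : ℝ) + 1) :=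
        hqd n ((inflate μ).tr γ x)
      rw [one_mul] at h1
      exact absurd (h1.trans hn) (not_lt.2 hx)
    rw [hempty, measure_empty]
  · rw [Measure.map_fst_prod]
    simp

theorem dense_marg_pos {V : Set Y} (hV : IsOpen V) (hne : V.Nonempty) :
    Dense {μ : BulletSim Γ | 0 < μ.marg V} := by
  intro μ
  -- mix in a small multiple of a sim whose marginal is Lebesgue measure
  let ν : BulletSim Γ := pushSim Adaptation.refl (trivialAction Γ Y volume)
  have hν : 0 < ν.marg V := (isGood_marg_pushSim _ _).2 V hV hne
  have ht : ∀ n : ℕ, 1 / ((n : ℝ) + 1) ∈ Icc (0 : ℝ) 1 := fun n =>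
    ⟨Nat.one_div_pos_of_nat.le, by
      rw [div_le_one (by positivity)]
      linarith [Nat.cast_nonneg (α := ℝ) n]⟩
  refine mem_closure_of_tendsto (f := fun n : ℕ => mix _ (ht n) μ ν) (b := atTop) ?_
    (Eventually.of_forall fun n => ?_)
  · rw [BulletSim.tendsto_iff]
    intro f
    have hint : ∀ κ : BulletSim Γ, Integrable f κ.toMeasure := fun κ =>
      Integrable.of_bound f.continuous.measurable.aestronglyMeasurable ‖f‖
        (ae_of_all _ fun y => f.norm_coe_le_norm _)
    have hI : ∀ n : ℕ, ∫ y, f y ∂(mix _ (ht n) μ ν).toMeasure =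
        (1 - 1 / ((n : ℝ) + 1)) * ∫ y, f y ∂μ.toMeasure +
          1 / ((n : ℝ) + 1) * ∫ y, f y ∂ν.toMeasure := by
      intro n
      rw [toMeasure_mix, integral_add_measure ((hint μ).smul_measure ENNReal.ofReal_ne_top)
        ((hint ν).smul_measure ENNReal.ofReal_ne_top), integral_smul_measure,
        integral_smul_measure, ENNReal.toReal_ofReal (sub_nonneg.2 (ht n).2),
        ENNReal.toReal_ofReal (ht n).1]
      rfl
    simp_rw [hI]
    have h0 := tendsto_one_div_add_atTop_nhds_zero_nat (𝕜 := ℝ)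
    have h1 := ((h0.const_sub 1).mul_const (∫ y, f y ∂μ.toMeasure)).add
      (h0.mul_const (∫ y, f y ∂ν.toMeasure))
    simpa using h1
  · have hm : (mix _ (ht n) μ ν).marg V =
        ENNReal.ofReal (1 - 1 / ((n : ℝ) + 1)) * μ.marg V +
          ENNReal.ofReal (1 / ((n : ℝ) + 1)) * ν.marg V := by
      rw [BulletSim.marg, toMeasure_mix, Measure.map_add _ _ (measurable_eval 1),
        Measure.map_smul, Measure.map_smul]
      rfl
    change 0 < (mix _ (ht n) μ ν).marg V
    rw [hm]
    refine lt_of_lt_of_le (ENNReal.mul_pos ?_ hν.ne') le_add_self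
    exact (ENNReal.ofReal_pos.2 Nat.one_div_pos_of_nat).ne'

/-- Graph-sims with good marginal are generic: the conditions are a countable family of open dense
ones. -/
theorem eventually_isGood_and_isGraph :
    ∀ᶠ μ : BulletSim Γ in residual (BulletSim Γ), IsGood μ.marg ∧ μ.IsGraph := by
  have h1 : ∀ n : ℕ, ∀ᶠ μ : BulletSim Γ in residual (BulletSim Γ),
      μ ∈ smallAtoms Γ (ENNReal.ofReal (1 / ((n : ℝ) + 1))) := fun n =>
    residual_of_dense_open (isOpen_smallAtoms _) (dense_isGraph.mono fun μ hμ =>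
      mem_smallAtoms hμ.1 (ENNReal.ofReal_pos.2 Nat.one_div_pos_of_nat))
  have h2 : ∀ V ∈ TopologicalSpace.countableBasis Y,
      ∀ᶠ μ : BulletSim Γ in residual (BulletSim Γ), 0 < μ.marg V := fun V hV => by
    have hVo := TopologicalSpace.isOpen_of_mem_countableBasis hV
    obtain ⟨m, hm, hmμ⟩ := exists_continuous_marg (Γ := Γ)
    refine residual_of_dense_open (s := {μ : BulletSim Γ | 0 < μ.marg V}) ?_
      (dense_marg_pos hVo (TopologicalSpace.nonempty_of_mem_countableBasis hV))
    simp_rw [← hmμ]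
    exact (isOpen_lt_measure_open hVo 0).preimage hm
  have h3 : ∀ (γ : Γ) (n : ℕ), ∀ᶠ μ : BulletSim Γ in residual (BulletSim Γ),
      μ ∈ nearGraph γ (1 / ((n : ℝ) + 1)) := fun γ n =>
    residual_of_dense_open (isOpen_nearGraph _ _) (dense_isGraph.mono fun μ hμ =>
      hμ.2.mem_nearGraph γ Nat.one_div_pos_of_nat)
  filter_upwards [eventually_countable_forall.2 h1,
    (eventually_countable_ball (TopologicalSpace.countable_countableBasis Y)).2 h2,
    eventually_countable_forall.2 fun γ => eventually_countable_forall.2 (h3 γ)] with μ k1 k2 k3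
  refine ⟨⟨fun y => ?_, fun V hV hne => ?_⟩, fun γ => exists_ae_eq_of_mem_nearGraph (k3 γ)⟩
  · have hlim : Tendsto (fun n : ℕ => ENNReal.ofReal (1 / ((n : ℝ) + 1))) atTop (𝓝 0) := by
      simpa using ENNReal.tendsto_ofReal tendsto_one_div_add_atTop_nhds_zero_nat
    exact le_antisymm (ge_of_tendsto' hlim fun n =>
      (measure_singleton_lt_of_mem_smallAtoms (k1 n) y).le) zero_le
  · obtain ⟨y, hy⟩ := hne
    obtain ⟨U, hU, -, hUV⟩ :=
      (TopologicalSpace.isBasis_countableBasis Y).exists_subset_of_mem_open hy hV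
    exact (k2 U hU).trans_le (measure_mono hUV)

theorem range_val_E : range (fun p : Adaptation × ActionSpace Γ => (E p).1) =
    {μ | IsGood μ.marg ∧ μ.IsGraph} := by
  ext μ
  constructor
  · rintro ⟨p, rfl⟩
    exact ⟨(E p).2, isGraph_E p⟩
  · rintro ⟨hg, hμ⟩
    obtain ⟨p, hp⟩ := exists_E_eq (μ := ⟨μ, hg⟩) hμ
    exact ⟨p, congrArg Subtype.val hp⟩

theorem isInducing_val_E :
    IsInducing (fun p : Adaptation × ActionSpace Γ => (E p).1) :=
  IsInducing.subtypeVal.comp isInducing_E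

theorem range_val_E_mem_residual :
    range (fun p : Adaptation × ActionSpace Γ => (E p).1) ∈ residual (BulletSim Γ) := by
  rw [range_val_E]
  exact eventually_isGood_and_isGraph

theorem denseRange_val_E : DenseRange (fun p : Adaptation × ActionSpace Γ => (E p).1) :=
  dense_of_mem_residual range_val_E_mem_residual

theorem graphSims_mem_residual : graphSims Γ ∈ residual (Sim Γ) := by
  have hr : range (Subtype.val : Sim Γ → BulletSim Γ) ∈ residual (BulletSim Γ) := by
    filter_upwards [eventually_isGood_and_isGraph] with μ hμ using ⟨⟨μ, hμ.1⟩, rfl⟩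
  have h : graphSims Γ = Subtype.val ⁻¹' {μ : BulletSim Γ | μ.IsGraph} :=
    ext mem_graphSims_iff
  rw [h]
  exact (mem_residual_preimage_iff (W := Sim Γ) IsInducing.subtypeVal (dense_of_mem_residual hr)
    hr _).2 (eventually_isGood_and_isGraph.mono fun μ hμ => hμ.2)

/-! ### Equivalence of the two settings -/

/-- The space of adaptations is not meagre in itself, since its product with the action space is
homeomorphic to a residual subspace of a Baire space. -/
instance neBot_residual_adaptation : (residual Adaptation).NeBot := by
  have hZ : (residual (BulletSim Unit)).NeBot := by
    rw [neBot_iff, Ne, ← empty_mem_iff_bot]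
    intro h
    exact (dense_of_mem_residual h).nonempty_iff.2
      ⟨pushSim Adaptation.refl (trivialAction Unit Y volume)⟩ |>.ne_empty rfl
  rw [neBot_iff, Ne, ← empty_mem_iff_bot] at hZ ⊢
  intro h
  have h1 : Prod.fst ⁻¹' (∅ : Set Adaptation) ∈ residual (Adaptation × ActionSpace Unit) :=
    tendsto_residual_of_isOpenMap continuous_fst isOpenMap_fst h
  rw [preimage_empty, ← preimage_empty (f := fun p : Adaptation × ActionSpace Unit => (E p).1),
    mem_residual_preimage_iff isInducing_val_E denseRange_val_E range_val_E_mem_residual] at h1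
  exact hZ h1

theorem dynGenEquiv_actionSetting_bulletSimSetting :
    DynGenEquiv (actionSetting Γ) (bulletSimSetting Γ) := by
  intro P hP
  let A : Set (ActionSpace Γ) := (actionSetting Γ).locus P
  let B : Set (BulletSim Γ) := (bulletSimSetting Γ).locus P
  have key : (fun p : Adaptation × ActionSpace Γ => (E p).1) ⁻¹' B = Prod.snd ⁻¹' A := by
    ext ⟨h, T⟩
    exact hP _ _ (isom_E h T)
  have hi := isInducing_val_E (Γ := Γ)
  have hd := denseRange_val_E (Γ := Γ)
  have hr := range_val_E_mem_residual (Γ := Γ)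
  refine ⟨?_, ?_, ?_⟩
  · change BaireMeasurableSet A ↔ BaireMeasurableSet B
    rw [← baireMeasurableSet_preimage_iff hi hd hr, key, baireMeasurableSet_preimage_snd_iff]
  · change IsMeagre A ↔ IsMeagre B
    rw [← isMeagre_preimage_iff hi hd hr, key, isMeagre_preimage_snd_iff]
  · change A ∈ residual (ActionSpace Γ) ↔ B ∈ residual (BulletSim Γ)
    rw [← mem_residual_preimage_iff hi hd hr, key, mem_residual_preimage_snd_iff]

end Countable

end GenericDynamics

theorem mainTheorem1 (Γ : Type) [Group Γ] [Countable Γ] :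
    GenericDynamics.DynGenEquiv
      (GenericDynamics.actionSetting Γ) (GenericDynamics.bulletSimSetting Γ) ∧
    IsEmbedding (GenericDynamics.E (Γ := Γ)) ∧
    Set.range (GenericDynamics.E (Γ := Γ)) = GenericDynamics.graphSims Γ ∧
    GenericDynamics.graphSims Γ ∈ residual (GenericDynamics.Sim Γ) ∧
    ∀ (h : GenericDynamics.Adaptation) (T : GenericDynamics.ActionSpace Γ),
      GenericDynamics.Isom (GenericDynamics.E (h, T)).1.system
        ((GenericDynamics.actionSetting Γ).sys T) :=
  ⟨GenericDynamics.dynGenEquiv_actionSetting_bulletSimSetting, GenericDynamics.isEmbedding_E,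
    GenericDynamics.range_E, GenericDynamics.graphSims_mem_residual, GenericDynamics.isom_E⟩
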